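/- **Setting.** There are $n$ bidders, $1\le k<n$; bidders $1,\dots,k$ are risk-neutral and bidders $k+1,\dots,n$ are risk-averse. All types have the same distribution $F$ on a compact interval $\Theta\subset\mathbb R_+$ (of positive length), with a continuous, strictly positive density $f$; let $v=F^{-1}:[0,1]\to\Theta$. The certainty equivalent is $g_i(x)=x$ for $i\le k$ and $g_i=g$ for $i>k$, where $g\in C^2[0,1]$, $g(x)\le x$, $g(0)=0$, $g(1)=1$, and $g'>0$, $g''>0$ on $(0,1)$. The function $x-g(x)$ is unimodal on $[0,1]$ with its maximum at $m\in(0,1)$. Put $$J_i(x,\theta)=\theta x-\tfrac{1-F(\theta)}{f(\theta)}\,g_i(x),\qquad H_i(x,u)=J_i(x,v(u)),$$ and assume that each $J_i$ is twice continuously differentiable on $[0,1]\times\Theta$. *Optimal reduced forms.* A reduced form is a tuple $\boldsymbol x=(x_1,\dots,x_n)$ of cumulative distribution functions on $[0,1]$ (weakly increasing, right-continuous, with $x_i(1)=1$). It is feasible if $\prod_i u_i+\sum_i\int_{u_i}^1 x_i(u)\,du\le 1$ for all $(u_1,\dots,u_n)\in[0,1]^n$, and optimal if it maximizes $\sum_i\int_0^1H_i(x_i(u),u)\,du$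 among feasible reduced forms. *Regularity.* For $0\le\delta\le t$ let $R_i(\delta,t)=\int_0^\delta\frac{\partial H_i}{\partial x}(e^{\tau-t},e^{-\tau})\,d\tau$, so that $\frac{\partial R_i}{\partial\delta}(\delta,t)=\frac{\partial H_i}{\partial x}(e^{\delta-t},e^{-\delta})$. The environment is regular if (A) each $R_i(\cdot,t)$ is strictly concave on $[0,t]$, and (B) for every $t\ge0$ the system $\frac{\partial R_i}{\partial\delta}(\delta_i,t)=p$ for all $i$, $\sum_i\delta_i=t$, $\delta_i\ge0$, has a unique solution $(\boldsymbol\delta^\sharp(t),p^\sharp(t))$, where each $\delta^\sharp_i$ is strictly increasing in $t$ and $p^\sharp$ is strictly decreasing in $t$. **Proposition.** Assume that the environment is regular, that each $H_i$ is supermodular on $[0,1]^2$, and that $\frac{\partial H_i}{\partial x}\big(m,m^{1/(n-1)}\big)>0$ for each $i$. Then an optimal reduced form exists. For every optimal reduced form $\boldsymbol x^*$, every risk-neutral bidder (say $1$), every risk-averse bidder (say $n$) and every $u\in(0,1)$: * $x_1^*(u)>x_n^*(u)$ if and only if $u>m^{1/(n-1)}$; * $x_1^*(u)=x_n^*(u)>0$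 if and only if $u=m^{1/(n-1)}$; * $x_1^*(u)<x_n^*(u)$ if and only if $u<m^{1/(n-1)}$ and $x_n^*(u)>0$. In other words, at every $u\in(0,1)$ at which $x_1^*(u)$ and $x_n^*(u)$ are not both zero, $x_1^*(u)\gtreqless x_n^*(u)$ if and only if $u\gtreqless m^{1/(n-1)}$ (and both can be zero only where $u<m^{1/(n-1)}$). Thus risk-averse bidders are favored at low quantiles and disfavored at high ones. -/

import Mathlib

open Set

noncomputable section

namespace CRA

/-- A distribution of types on a compact interval `[lo, hi]` of nonnegative reals, given by a
strictly positive continuous density `f`. -/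
structure TypeDistribution where
  lo : ℝ
  hi : ℝ
  f : ℝ → ℝ
  lo_nonneg : 0 ≤ lo
  lo_lt_hi : lo < hi
  f_cont : ContinuousOn f (Icc lo hi)
  f_pos : ∀ θ ∈ Icc lo hi, 0 < f θ
  f_total : ∫ θ in lo..hi, f θ = 1

/-- The cumulative distribution function `F` (on `[lo, hi]`). -/
def TypeDistribution.F (D : TypeDistribution) (θ : ℝ) : ℝ := ∫ s in D.lo..θ, D.f s

/-- The quantile function `v = F⁻¹ : [0,1] → [lo, hi]`. -/
def TypeDistribution.v (D : TypeDistribution) (u : ℝ) : ℝ :=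
  Function.invFunOn D.F (Icc D.lo D.hi) u

/-- Revenue `J(x, θ) = θ x - (1 - F θ) / f θ * c x` from selling with probability `x` to type `θ` of
a bidder with certainty equivalent `c`. -/
def TypeDistribution.J (D : TypeDistribution) (c : ℝ → ℝ) (x θ : ℝ) : ℝ :=
  θ * x - (1 - D.F θ) / D.f θ * c x

/-- Certainty equivalents: the first `k` bidders (indices `0, …, k - 1`) are risk-neutral, the others
have certainty equivalent `g`. -/
def certEquiv {n : ℕ} (k : ℕ) (g : ℝ → ℝ) (i : Fin n) : ℝ → ℝ :=
  if i.val < k then fun x => x else g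

/-- Revenue functions in quantile space, `H_i(x, u) = J_i(x, F⁻¹(u))`. -/
def revenueFn (D : TypeDistribution) {n : ℕ} (k : ℕ) (g : ℝ → ℝ) (i : Fin n) (x u : ℝ) : ℝ :=
  D.J (certEquiv k g i) x (D.v u)

/-- The certainty equivalent of a risk-averse bidder. The derivatives are required to be positive on
the open interval, so that for example `g x = x ^ 2` is allowed. -/
structure IsRiskAverse (g : ℝ → ℝ) : Prop where
  contDiff : ContDiffOn ℝ 2 g (Icc 0 1)
  zero : g 0 = 0
  one : g 1 = 1
  le_self : ∀ x ∈ Icc (0 : ℝ) 1, g x ≤ x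
  deriv_pos : ∀ x ∈ Ioo (0 : ℝ) 1, 0 < deriv g x
  deriv2_pos : ∀ x ∈ Ioo (0 : ℝ) 1, 0 < deriv (deriv g) x

/-- `φ` is unimodal on `[0,1]` with its maximum at `m`. -/
def IsUnimodalAt (φ : ℝ → ℝ) (m : ℝ) : Prop :=
  MonotoneOn φ (Icc 0 m) ∧ AntitoneOn φ (Icc m 1)

/-- Supermodularity on the lattice `[0,1]²`. -/
def IsSupermodular (H : ℝ → ℝ → ℝ) : Prop :=
  ∀ x ∈ Icc (0 : ℝ) 1, ∀ y ∈ Icc (0 : ℝ) 1, ∀ u ∈ Icc (0 : ℝ) 1, ∀ w ∈ Icc (0 : ℝ) 1,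
    H x u + H y w ≤ H (max x y) (max u w) + H (min x y) (min u w)

/-- The partial derivative `∂H/∂x` on `[0,1]²` (one-sided at `x = 0` and `x = 1`). -/
def partialX (H : ℝ → ℝ → ℝ) (x u : ℝ) : ℝ := derivWithin (fun y => H y u) (Icc 0 1) x

/-- The marginal revenue `∂R/∂δ (δ, t) = ∂H/∂x (e^{δ-t}, e^{-δ})`, for `0 ≤ δ ≤ t`; it is the
`δ`-derivative of `cumRevenue` below. -/
def marginalRevenue (H : ℝ → ℝ → ℝ) (δ t : ℝ) : ℝ :=
  partialX H (Real.exp (δ - t)) (Real.exp (-δ))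

/-- `R(δ, t) = ∫_0^δ ∂H/∂x (e^{τ-t}, e^{-τ}) dτ`, for `0 ≤ δ ≤ t`. -/
def cumRevenue (H : ℝ → ℝ → ℝ) (δ t : ℝ) : ℝ := ∫ τ in (0 : ℝ)..δ, marginalRevenue H τ t

/-- `(δ, p)` solves the system `∂R_i/∂δ (δ_i, t) = p` for all `i`, `∑ δ_i = t`
(where `δ_i ≥ 0`, hence `0 ≤ δ_i ≤ t`). -/
def SolvesSystem {n : ℕ} (H : Fin n → ℝ → ℝ → ℝ) (t : ℝ) (δ : Fin n → ℝ) (p : ℝ) : Prop :=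
  (∀ i, 0 ≤ δ i) ∧ (∀ i, marginalRevenue (H i) (δ i) t = p) ∧ ∑ i, δ i = t

/-- Regularity of an environment: strict concavity of each `R_i` in its first argument, and, for
each `t ≥ 0`, a unique solution of the system above, such that the path is strictly increasing
and the common marginal revenue strictly decreasing. -/
def IsRegular {n : ℕ} (H : Fin n → ℝ → ℝ → ℝ) : Prop :=
  (∀ i, ∀ t : ℝ, 0 ≤ t → StrictConcaveOn ℝ (Icc 0 t) (fun δ => cumRevenue (H i) δ t)) ∧
  ∃ (δs : ℝ → Fin n → ℝ) (ps : ℝ → ℝ),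
    (∀ t : ℝ, 0 ≤ t → ∀ (δ : Fin n → ℝ) (p : ℝ), SolvesSystem H t δ p ↔ δ = δs t ∧ p = ps t) ∧
    (∀ i, StrictMonoOn (fun t => δs t i) (Ici 0)) ∧
    StrictAntiOn ps (Ici 0)

/-- Cumulative distribution functions on the unit interval. -/
structure IsCDF (x : ℝ → ℝ) : Prop where
  mem : ∀ u ∈ Icc (0 : ℝ) 1, x u ∈ Icc (0 : ℝ) 1
  mono : MonotoneOn x (Icc 0 1)
  rightCont : ∀ u ∈ Ico (0 : ℝ) 1, ContinuousWithinAt x (Ici u) u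
  one : x 1 = 1

/-- Feasible reduced forms: tuples of CDFs on `[0,1]` that satisfy the Border constraints. -/
def IsFeasible {n : ℕ} (x : Fin n → ℝ → ℝ) : Prop :=
  (∀ i, IsCDF (x i)) ∧
  ∀ w : Fin n → ℝ, (∀ i, w i ∈ Icc (0 : ℝ) 1) →
    ∏ i, w i + ∑ i, ∫ u in (w i)..1, x i u ≤ 1

/-- Expected revenue of a reduced form. -/
def revenue {n : ℕ} (H : Fin n → ℝ → ℝ → ℝ) (x : Fin n → ℝ → ℝ) : ℝ :=
  ∑ i, ∫ u in (0 : ℝ)..1, H i (x i u) u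

/-- Optimal reduced forms: feasible ones that maximize expected revenue. -/
def IsOptimal {n : ℕ} (H : Fin n → ℝ → ℝ → ℝ) (x : Fin n → ℝ → ℝ) : Prop :=
  IsFeasible x ∧ ∀ y, IsFeasible y → revenue H y ≤ revenue H x

end CRA

end

namespace CRA

/-! Put `w i = e^{-δ_i}` and `t = ∑ δ_i` in the Border constraint. Its product term is `e^{-t}`, and
its first-order condition in coordinate `i` is `x_i(e^{-δ_i}) = e^{δ_i - t}`. The solutions of the
regularity system trace a path of vectors `δ t`, and the reduced form `BorderPath.form` defined by
this condition satisfies every Border constraint, with equality along the path (`border_form_le`,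
`border_form_eq`).

The common marginal revenue `p t` acts as a multiplier. Quantile `u` of bidder `i` gets as price the
positive part of `p` at the time the path reaches it. The truncated form `optForm` maximizes `H_i(x,
u) - price * x` pointwise (`optForm_maximizes`). By the layer-cake formula, the price-weighted
difference between `optForm` and a feasible `y` is an integral over prices of Border slacks of `y`.
So the revenue gap is a sum of nonnegative losses and slacks (`revenue_sub`), which proves
optimality. If `y` is also optimal, losses and slacks vanish almost everywhere. Hence the Border
constraints bind for `y` along the path while `p ≥ 0` (`border_eq`), and varying one coordinate
determines `y` there (`optimal_quantile`). At the remaining quantiles in `(0, 1)` a risk-neutral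
bidder gets zero.

For the comparison, `m` maximizes `x - g x`, so `g' = 1` at `m` and all marginal revenues agree when
everybody has quantile `m^{1/(n-1)}`. By uniqueness the path passes through this symmetric point, at
a time `T` with positive price. Strict monotonicity of `g'` and the sum condition put the
risk-neutral bidders ahead on the path before `T` and behind after it. Whoever reaches a given
quantile earlier wins there more often, as `e^{δ - t}` decreases in `t`. -/

/-! ### Elementary estimates. -/

/-- A substitute for "nonpositive derivative implies nonincreasing", needed because paths are only
Lipschitz. Cutting `[0, T]` into `N + 1` equal pieces leaves a total error `C T² / (N + 1)`. -/
theorem le_of_le_add_sq {h : ℝ → ℝ} {C T : ℝ} (hT : 0 ≤ T)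
    (hh : ∀ s t, 0 ≤ s → s ≤ t → t ≤ T → h t ≤ h s + C * (t - s) ^ 2) : h T ≤ h 0 := by
  have key : ∀ N : ℕ, h T ≤ h 0 + C * T ^ 2 * (1 / ((N : ℝ) + 1)) := by
    intro N
    have hN : (0 : ℝ) < (N : ℝ) + 1 := by positivity
    have step : ∀ l : ℕ, l ≤ N + 1 →
        h (T * l / (N + 1)) ≤ h 0 + l * (C * (T / (N + 1)) ^ 2) := by
      intro l
      induction l with
      | zero => intro _; simp
      | succ l ih =>
        intro hl
        have h1 := ih (by omega)
        have hl' : ((l : ℝ) + 1) ≤ N + 1 := by exact_mod_cast hl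
        have h2 := hh (T * l / (N + 1)) (T * (l + 1 : ℕ) / (N + 1)) (by positivity)
          (by push_cast; gcongr; linarith)
          (by push_cast; rw [div_le_iff₀ hN]; gcongr)
        have h3 : T * ((l + 1 : ℕ) : ℝ) / (N + 1) - T * l / (N + 1) = T / (N + 1) := by
          push_cast; ring
        rw [h3] at h2
        push_cast at h2 ⊢
        linarith
    have h4 := step (N + 1) le_rfl
    have h5 : T * ((N + 1 : ℕ) : ℝ) / (N + 1) = T := by push_cast; field_simp
    rw [h5] at h4
    refine h4.trans (le_of_eq ?_)
    push_cast
    field_simp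
  have lim : Filter.Tendsto (fun N : ℕ => h 0 + C * T ^ 2 * (1 / ((N : ℝ) + 1)))
      Filter.atTop (nhds (h 0 + C * T ^ 2 * 0)) :=
    (tendsto_one_div_add_atTop_nhds_zero_nat.const_mul _).const_add _
  have := ge_of_tendsto' lim key
  simpa using this

/-- First-order expansion of a product with a quadratic remainder, to be fed into `le_of_le_add_sq`.
-/
theorem abs_prod_sub_prod_sub_le {ι : Type*} [DecidableEq ι] (s : Finset ι) (a b : ι → ℝ)
    (ha : ∀ i, a i ∈ Icc (0 : ℝ) 1) (hb : ∀ i, b i ∈ Icc (0 : ℝ) 1) :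
    |∏ i ∈ s, a i - ∏ i ∈ s, b i - ∑ i ∈ s, (a i - b i) * ∏ j ∈ s.erase i, a j| ≤
      (∑ i ∈ s, |a i - b i|) ^ 2 := by
  induction s using Finset.induction_on with
  | empty => simp
  | insert k s hk ih =>
    rw [Finset.prod_insert hk, Finset.prod_insert hk, Finset.sum_insert hk, Finset.sum_insert hk,
      Finset.erase_insert hk]
    have h1 : ∑ i ∈ s, (a i - b i) * ∏ j ∈ (insert k s).erase i, a j =
        a k * ∑ i ∈ s, (a i - b i) * ∏ j ∈ s.erase i, a j := by
      rw [Finset.mul_sum]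
      refine Finset.sum_congr rfl fun i hi => ?_
      have hik : k ≠ i := fun h => hk (h ▸ hi)
      rw [Finset.erase_insert_of_ne hik, Finset.prod_insert (fun h => hk (Finset.mem_of_mem_erase h))]
      ring
    have h2 : |∑ i ∈ s, (a i - b i) * ∏ j ∈ s.erase i, a j| ≤ ∑ i ∈ s, |a i - b i| := by
      refine (Finset.abs_sum_le_sum_abs _ _).trans (Finset.sum_le_sum fun i _ => ?_)
      rw [abs_mul]
      refine mul_le_of_le_one_right (abs_nonneg _) ?_
      rw [Finset.abs_prod]
      exact Finset.prod_le_one (fun j _ => abs_nonneg _) fun j _ => by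
        rw [abs_of_nonneg (ha j).1]; exact (ha j).2
    rw [h1]
    set A := ∏ i ∈ s, a i
    set B := ∏ i ∈ s, b i
    set S := ∑ i ∈ s, (a i - b i) * ∏ j ∈ s.erase i, a j
    set E := ∑ i ∈ s, |a i - b i|
    have hE : 0 ≤ E := Finset.sum_nonneg fun i _ => abs_nonneg _
    have h3 : a k * A - b k * B - ((a k - b k) * A + a k * S) =
        b k * (A - B - S) - (a k - b k) * S := by ring
    rw [h3]
    have h4 : |b k * (A - B - S)| ≤ E ^ 2 := by
      rw [abs_mul, abs_of_nonneg (hb k).1]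
      exact (mul_le_of_le_one_left (abs_nonneg _) (hb k).2).trans ih
    have h5 : |(a k - b k) * S| ≤ |a k - b k| * E := by
      rw [abs_mul]; gcongr
    have h6 := abs_sub (b k * (A - B - S)) ((a k - b k) * S)
    nlinarith [abs_nonneg (a k - b k)]

/-! ### Paths of quantiles and the reduced forms that bind along them. -/

/-- A path of vectors of log-quantiles `δ t`, indexed by their sum. -/
structure BorderPath (n : ℕ) where
  δ : ℝ → Fin n → ℝ
  nonneg : ∀ t, 0 ≤ t → ∀ i, 0 ≤ δ t i
  sum_eq : ∀ t, 0 ≤ t → ∑ i, δ t i = t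
  strictMono : ∀ i, StrictMonoOn (fun t => δ t i) (Ici 0)

namespace BorderPath

variable {n : ℕ} (π : BorderPath n)

/-- The quantile of bidder `i` at time `t`. -/
noncomputable def quantile (t : ℝ) (i : Fin n) : ℝ := Real.exp (-π.δ t i)

/-- The product of the quantiles of the other bidders at time `t`. -/
noncomputable def winProb (t : ℝ) (i : Fin n) : ℝ := Real.exp (π.δ t i - t)

/-- The reduced form for which the Border constraints bind along the path. -/
noncomputable def form (i : Fin n) (u : ℝ) : ℝ :=
  sInf ((fun t => π.winProb t i) '' {t | 0 ≤ t ∧ u ≤ π.quantile t i})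

theorem mono {s t : ℝ} (hs : 0 ≤ s) (hst : s ≤ t) (i : Fin n) : π.δ s i ≤ π.δ t i :=
  (π.strictMono i).monotoneOn hs (hs.trans hst : (0 : ℝ) ≤ t) hst

theorem lt_iff {s t : ℝ} (hs : 0 ≤ s) (ht : 0 ≤ t) (i : Fin n) : π.δ s i < π.δ t i ↔ s < t :=
  (π.strictMono i).lt_iff_lt hs ht

theorem le_iff {s t : ℝ} (hs : 0 ≤ s) (ht : 0 ≤ t) (i : Fin n) : π.δ s i ≤ π.δ t i ↔ s ≤ t :=
  (π.strictMono i).le_iff_le hs ht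

theorem sum_sub {s t : ℝ} (hs : 0 ≤ s) (hst : s ≤ t) : ∑ i, (π.δ t i - π.δ s i) = t - s := by
  rw [Finset.sum_sub_distrib, π.sum_eq t (hs.trans hst), π.sum_eq s hs]

theorem sub_le {s t : ℝ} (hs : 0 ≤ s) (hst : s ≤ t) (i : Fin n) :
    π.δ t i - π.δ s i ≤ t - s := by
  rw [← π.sum_sub hs hst]
  exact Finset.single_le_sum (f := fun i => π.δ t i - π.δ s i)
    (fun j _ => sub_nonneg.2 (π.mono hs hst j)) (Finset.mem_univ i)

/-- The increments of the coordinates are nonnegative and add up to the increment of `t`, so each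
coordinate is 1-Lipschitz. -/
theorem continuousOn (i : Fin n) : ContinuousOn (fun t => π.δ t i) (Ici 0) := by
  have : LipschitzOnWith 1 (fun t => π.δ t i) (Ici 0) := by
    refine LipschitzOnWith.of_dist_le_mul fun s hs t ht => ?_
    simp only [NNReal.coe_one, one_mul, Real.dist_eq]
    rcases le_total s t with h | h
    · rw [abs_sub_comm, abs_sub_comm s, abs_of_nonneg (sub_nonneg.2 (π.mono hs h i)),
        abs_of_nonneg (sub_nonneg.2 h)]
      exact π.sub_le hs h i
    · rw [abs_of_nonneg (sub_nonneg.2 (π.mono ht h i)), abs_of_nonneg (sub_nonneg.2 h)]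
      exact π.sub_le ht h i
  exact this.continuousOn

theorem δ_zero (i : Fin n) : π.δ 0 i = 0 := by
  have h := π.sum_eq 0 le_rfl
  rw [Finset.sum_eq_zero_iff_of_nonneg fun j _ => π.nonneg 0 le_rfl j] at h
  exact h i (Finset.mem_univ i)

theorem quantile_zero (i : Fin n) : π.quantile 0 i = 1 := by simp [quantile, δ_zero]

theorem quantile_pos (t : ℝ) (i : Fin n) : 0 < π.quantile t i := Real.exp_pos _

theorem quantile_le_one {t : ℝ} (ht : 0 ≤ t) (i : Fin n) : π.quantile t i ≤ 1 :=
  Real.exp_le_one_iff.2 (neg_nonpos.2 (π.nonneg t ht i))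

theorem quantile_mem {t : ℝ} (ht : 0 ≤ t) (i : Fin n) : π.quantile t i ∈ Icc (0 : ℝ) 1 :=
  ⟨(π.quantile_pos t i).le, π.quantile_le_one ht i⟩

theorem quantile_lt_iff {s t : ℝ} (hs : 0 ≤ s) (ht : 0 ≤ t) (i : Fin n) :
    π.quantile s i < π.quantile t i ↔ t < s := by
  rw [quantile, quantile, Real.exp_lt_exp, neg_lt_neg_iff, π.lt_iff ht hs]

theorem quantile_le_iff {s t : ℝ} (hs : 0 ≤ s) (ht : 0 ≤ t) (i : Fin n) :
    π.quantile s i ≤ π.quantile t i ↔ t ≤ s := by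
  rw [quantile, quantile, Real.exp_le_exp, neg_le_neg_iff, π.le_iff ht hs]

theorem quantile_continuousOn (i : Fin n) :
    ContinuousOn (fun t => π.quantile t i) (Ici 0) :=
  Real.continuous_exp.comp_continuousOn (π.continuousOn i).neg

theorem winProb_continuousOn (i : Fin n) :
    ContinuousOn (fun t => π.winProb t i) (Ici 0) :=
  Real.continuous_exp.comp_continuousOn ((π.continuousOn i).sub continuousOn_id)

theorem winProb_pos (t : ℝ) (i : Fin n) : 0 < π.winProb t i := Real.exp_pos _

theorem winProb_zero (i : Fin n) : π.winProb 0 i = 1 := by simp [winProb, δ_zero]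

theorem winProb_anti {s t : ℝ} (hs : 0 ≤ s) (hst : s ≤ t) (i : Fin n) :
    π.winProb t i ≤ π.winProb s i := by
  have := π.sub_le hs hst i
  exact Real.exp_le_exp.2 (by linarith)

theorem winProb_le_one {t : ℝ} (ht : 0 ≤ t) (i : Fin n) : π.winProb t i ≤ 1 :=
  (π.winProb_anti le_rfl ht i).trans_eq (π.winProb_zero i)

theorem winProb_mem {t : ℝ} (ht : 0 ≤ t) (i : Fin n) : π.winProb t i ∈ Icc (0 : ℝ) 1 :=
  ⟨(π.winProb_pos t i).le, π.winProb_le_one ht i⟩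

theorem prod_quantile {t : ℝ} (ht : 0 ≤ t) : ∏ i, π.quantile t i = Real.exp (-t) := by
  simp only [quantile]
  rw [← Real.exp_sum, Finset.sum_neg_distrib, π.sum_eq t ht]

theorem quantile_mul_winProb (t : ℝ) (i : Fin n) :
    π.quantile t i * π.winProb t i = Real.exp (-t) := by
  rw [quantile, winProb, ← Real.exp_add]; congr 1; ring

theorem winProb_eq_prod {t : ℝ} (ht : 0 ≤ t) (i : Fin n) :
    π.winProb t i = ∏ j ∈ Finset.univ.erase i, π.quantile t j := by
  have h := π.prod_quantile ht
  rw [← Finset.mul_prod_erase _ _ (Finset.mem_univ i), ← π.quantile_mul_winProb t i] at h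
  exact (mul_left_cancel₀ (π.quantile_pos t i).ne' h).symm

theorem quantile_sub_le {s t : ℝ} (hs : 0 ≤ s) (hst : s ≤ t) (i : Fin n) :
    |π.quantile s i - π.quantile t i| ≤ π.δ t i - π.δ s i := by
  have h1 := (π.quantile_le_iff (hs.trans hst) hs i).2 hst
  rw [abs_of_nonneg (sub_nonneg.2 h1)]
  have h2 : π.quantile t i = π.quantile s i * Real.exp (-(π.δ t i - π.δ s i)) := by
    rw [quantile, quantile, ← Real.exp_add]; congr 1; ring
  have h3 := Real.add_one_le_exp (-(π.δ t i - π.δ s i))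
  have h4 := π.quantile_mem hs i
  have h5 := π.mono hs hst i
  rw [h2]
  nlinarith [h4.1, h4.2]

/-! ### The reduced form of a path -/

theorem form_bddBelow (i : Fin n) (u : ℝ) :
    BddBelow ((fun t => π.winProb t i) '' {t | 0 ≤ t ∧ u ≤ π.quantile t i}) :=
  ⟨0, by rintro _ ⟨t, _, rfl⟩; exact (π.winProb_pos t i).le⟩

theorem form_nonneg (i : Fin n) (u : ℝ) : 0 ≤ π.form i u :=
  Real.sInf_nonneg (by rintro _ ⟨t, _, rfl⟩; exact (π.winProb_pos t i).le)

theorem form_le {i : Fin n} {u t : ℝ} (ht : 0 ≤ t) (hu : u ≤ π.quantile t i) :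
    π.form i u ≤ π.winProb t i :=
  csInf_le (π.form_bddBelow i u) ⟨t, ⟨ht, hu⟩, rfl⟩

theorem le_form {i : Fin n} {u c : ℝ} (hu : u ≤ 1)
    (h : ∀ t, 0 ≤ t → u ≤ π.quantile t i → c ≤ π.winProb t i) : c ≤ π.form i u :=
  le_csInf ⟨_, 0, ⟨le_rfl, by rwa [quantile_zero]⟩, rfl⟩
    (by rintro _ ⟨t, ht, rfl⟩; exact h t ht.1 ht.2)

theorem form_mono (i : Fin n) : MonotoneOn (π.form i) (Iic 1) := fun _ _ _ hb hab =>
  π.le_form hb fun _ ht hbt => π.form_le ht (hab.trans hbt)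

theorem form_quantile {t : ℝ} (ht : 0 ≤ t) (i : Fin n) :
    π.form i (π.quantile t i) = π.winProb t i :=
  le_antisymm (π.form_le ht le_rfl) (π.le_form (π.quantile_le_one ht i) fun _ hs h =>
    π.winProb_anti hs ((π.quantile_le_iff ht hs i).1 h) i)

theorem form_one (i : Fin n) : π.form i 1 = 1 := by
  simpa only [quantile_zero, winProb_zero] using π.form_quantile le_rfl i

theorem form_intervalIntegrable (i : Fin n) {a b : ℝ} (ha : a ≤ 1) (hb : b ≤ 1) :
    IntervalIntegrable (π.form i) MeasureTheory.volume a b :=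
  MonotoneOn.intervalIntegrable ((π.form_mono i).mono fun x hx => by
    rw [uIcc, mem_Icc] at hx; exact hx.2.trans (sup_le ha hb))

theorem winProb_mul_le {u t : ℝ} {i : Fin n} (hu : u ≤ π.quantile t i) :
    u * π.winProb t i ≤ Real.exp (-t) := by
  rw [← π.quantile_mul_winProb t i]
  exact mul_le_mul_of_nonneg_right hu (π.winProb_pos t i).le

theorem exists_quantile_eq {u : ℝ} (hu : u ≤ 1) (i : Fin n) {t : ℝ} (ht : 0 ≤ t)
    (h : π.quantile t i ≤ u) : ∃ s, 0 ≤ s ∧ s ≤ t ∧ π.quantile s i = u := by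
  have hc : ContinuousOn (fun t => π.quantile t i) (Icc 0 t) :=
    (π.quantile_continuousOn i).mono fun s hs => hs.1
  obtain ⟨s, hs, rfl⟩ := intermediate_value_Icc' ht hc ⟨h, by simpa [quantile_zero] using hu⟩
  exact ⟨s, hs.1, hs.2, rfl⟩

/-- Quantile times winning probability is `e^{-t}`, so `u * c ≤ e^{-t}` for all `t`. This covers
quantiles that the path never reaches. -/
theorem eq_zero_of_forall_le {u c : ℝ} {i : Fin n} (hu : 0 < u) (hc : 0 ≤ c)
    (h : ∀ t, 0 ≤ t → u ≤ π.quantile t i ∧ c ≤ π.winProb t i) : c = 0 := by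
  refine le_antisymm ?_ hc
  have h1 : ∀ᶠ t in Filter.atTop, u * c ≤ Real.exp (-t) := by
    filter_upwards [Filter.eventually_ge_atTop 0] with t ht
    exact (mul_le_mul_of_nonneg_left (h t ht).2 hu.le).trans (π.winProb_mul_le (h t ht).1)
  have h2 := ge_of_tendsto Real.tendsto_exp_neg_atTop_nhds_zero h1
  by_contra hcon
  push Not at hcon
  nlinarith [mul_pos hu hcon]

/-- Right-continuity of the monotone `form`: stepping back slightly in time raises the quantile and
changes the winning probability continuously. -/
theorem form_lt_of_lt {i : Fin n} {u r : ℝ} (hu : u < 1) (hr : π.form i u < r) :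
    ∃ u', u < u' ∧ u' ≤ 1 ∧ π.form i u' < r := by
  have hnonempty : ((fun t => π.winProb t i) '' {t | 0 ≤ t ∧ u ≤ π.quantile t i}).Nonempty :=
    ⟨_, 0, ⟨le_rfl, by rw [quantile_zero]; exact hu.le⟩, rfl⟩
  obtain ⟨_, ⟨t, ⟨ht, hut⟩, rfl⟩, hlt⟩ := exists_lt_of_csInf_lt hnonempty hr
  rcases ht.eq_or_lt with rfl | ht'
  · exact ⟨1, hu, le_rfl, by simpa [form_one, winProb_zero] using hlt⟩
  have hc : ContinuousWithinAt (fun t => π.winProb t i) (Ico 0 t) t :=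
    ((π.winProb_continuousOn i) t ht).mono fun s hs => hs.1
  have hne : (nhdsWithin t (Ico 0 t)).NeBot := by
    rw [nhdsWithin_Ico_eq_nhdsLT ht']; infer_instance
  obtain ⟨s, hs1, hs2⟩ := ((hc.eventually (gt_mem_nhds hlt)).and self_mem_nhdsWithin).exists
  exact ⟨π.quantile s i, hut.trans_lt ((π.quantile_lt_iff ht hs2.1 i).2 hs2.2),
    π.quantile_le_one hs2.1 i, by rwa [π.form_quantile hs2.1]⟩

/-- The point `max (w i) (quantile s i)` starts at `(1, …, 1)`, where the Border expression is 1. As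
`s` grows the expression does not increase: only coordinates equal to their path quantile move, and
there `form` is the product of the other path quantiles, at most the product of the other
coordinates. -/
theorem prod_max_add_le (w : Fin n → ℝ) (hw : ∀ i, w i ∈ Icc (0 : ℝ) 1) {T : ℝ} (hT : 0 ≤ T) :
    ∏ i, max (w i) (π.quantile T i) +
      ∑ i, ∫ u in (max (w i) (π.quantile T i))..1, π.form i u ≤ 1 := by
  set a : ℝ → Fin n → ℝ := fun s i => max (w i) (π.quantile s i) with ha
  have hmem : ∀ s, 0 ≤ s → ∀ i, a s i ∈ Icc (0 : ℝ) 1 := fun s hs i =>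
    ⟨(hw i).1.trans (le_max_left _ _), max_le (hw i).2 (π.quantile_le_one hs i)⟩
  have h0 : ∀ i, a 0 i = 1 := fun i => by simp [ha, quantile_zero, (hw i).2]
  have main := le_of_le_add_sq (h := fun s => ∏ i, a s i + ∑ i, ∫ u in (a s i)..1, π.form i u)
    (C := 1) hT ?_
  · simpa [h0] using main
  intro s t hs hst _
  have ht := hs.trans hst
  have h1 := abs_prod_sub_prod_sub_le Finset.univ (a s) (a t) (hmem s hs) (hmem t ht)
  have h2 : ∑ i, |a s i - a t i| ≤ t - s := by
    rw [← π.sum_sub hs hst]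
    refine Finset.sum_le_sum fun i _ => (le_trans ?_ (π.quantile_sub_le hs hst i))
    simpa [ha] using abs_max_sub_max_le_abs (π.quantile s i) (π.quantile t i) (w i) |>
      fun h => by simpa only [max_comm] using h
  have h3 : (∑ i, |a s i - a t i|) ^ 2 ≤ (t - s) ^ 2 :=
    pow_le_pow_left₀ (Finset.sum_nonneg fun i _ => abs_nonneg _) h2 2
  have h4 : ∑ i, (∫ u in (a t i)..1, π.form i u) ≤ ∑ i, (∫ u in (a s i)..1, π.form i u) +
      ∑ i, (a s i - a t i) * ∏ j ∈ Finset.univ.erase i, a s j := by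
    rw [← Finset.sum_add_distrib]
    refine Finset.sum_le_sum fun i _ => ?_
    rw [← intervalIntegral.integral_add_adjacent_intervals
      (π.form_intervalIntegrable i (hmem t ht i).2 (hmem s hs i).2)
      (π.form_intervalIntegrable i (hmem s hs i).2 le_rfl), add_comm]
    gcongr
    have hq := (π.quantile_le_iff ht hs i).2 hst
    have hle : a t i ≤ a s i := max_le_max le_rfl hq
    rcases hle.eq_or_lt with he | hlt
    · rw [he]; simp
    -- A coordinate bounded by `w i` at time `s` could not decrease any further.
    have hsi : a s i = π.quantile s i := by
      refine max_eq_right (le_of_lt ?_)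
      by_contra hcon
      push Not at hcon
      have : a s i = w i := max_eq_left hcon
      exact absurd (le_max_left (w i) (π.quantile t i)) (not_le.2 (hlt.trans_eq this))
    calc ∫ u in (a t i)..(a s i), π.form i u
        ≤ ∫ u in (a t i)..(a s i), ∏ j ∈ Finset.univ.erase i, a s j := by
          refine intervalIntegral.integral_mono_on hle
            (π.form_intervalIntegrable i (hmem t ht i).2 (hmem s hs i).2) (by simp) fun u hu => ?_
          have h5 : π.form i u ≤ π.winProb s i := π.form_le hs (hsi ▸ hu.2)
          refine h5.trans ?_
          rw [π.winProb_eq_prod hs]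
          exact Finset.prod_le_prod (fun j _ => (π.quantile_pos s j).le)
            fun j _ => le_max_right _ _
      _ = _ := by simp
  have h6 := abs_le.1 h1
  linarith [h6.1]

/-- Replacing `max (w i) (quantile T i)` by `w i` adds at most quantile times winning probability,
which is `e^{-T}`, for each bidder. Then `T` tends to infinity. -/
theorem border_form_le (w : Fin n → ℝ) (hw : ∀ i, w i ∈ Icc (0 : ℝ) 1) :
    ∏ i, w i + ∑ i, ∫ u in (w i)..1, π.form i u ≤ 1 := by
  have key : ∀ᶠ T in Filter.atTop,
      ∏ i, w i + ∑ i, ∫ u in (w i)..1, π.form i u ≤ 1 + n * Real.exp (-T) := by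
    filter_upwards [Filter.eventually_ge_atTop 0] with T hT
    have h1 := π.prod_max_add_le w hw hT
    have h2 : ∏ i, w i ≤ ∏ i, max (w i) (π.quantile T i) :=
      Finset.prod_le_prod (fun i _ => (hw i).1) fun i _ => le_max_left _ _
    have h3 : ∑ i, (∫ u in (w i)..1, π.form i u) ≤
        ∑ i, ((∫ u in (max (w i) (π.quantile T i))..1, π.form i u) + Real.exp (-T)) := by
      refine Finset.sum_le_sum fun i _ => ?_
      have hm : max (w i) (π.quantile T i) ≤ 1 := max_le (hw i).2 (π.quantile_le_one hT i)
      rw [← intervalIntegral.integral_add_adjacent_intervals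
        (π.form_intervalIntegrable i (hw i).2 hm) (π.form_intervalIntegrable i hm le_rfl), add_comm]
      gcongr
      rcases le_total (π.quantile T i) (w i) with h | h
      · rw [max_eq_left h]; simpa using (Real.exp_pos _).le
      · rw [max_eq_right h]
        calc ∫ u in (w i)..(π.quantile T i), π.form i u
            ≤ ∫ u in (w i)..(π.quantile T i), π.winProb T i :=
              intervalIntegral.integral_mono_on h
                (π.form_intervalIntegrable i (hw i).2 (π.quantile_le_one hT i)) (by simp)
                fun u hu => π.form_le hT hu.2
          _ = (π.quantile T i - w i) * π.winProb T i := by simp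
          _ ≤ π.quantile T i * π.winProb T i := by
              gcongr
              · exact (π.winProb_pos T i).le
              · linarith [(hw i).1]
          _ = _ := π.quantile_mul_winProb T i
    rw [Finset.sum_add_distrib] at h3
    simp only [Finset.sum_const, Finset.card_univ, Fintype.card_fin, nsmul_eq_mul] at h3
    linarith
  have lim : Filter.Tendsto (fun T : ℝ => 1 + n * Real.exp (-T)) Filter.atTop
      (nhds (1 + n * 0)) :=
    (Real.tendsto_exp_neg_atTop_nhds_zero.const_mul _).const_add _
  simpa using ge_of_tendsto lim key

theorem border_form_eq {T : ℝ} (hT : 0 ≤ T) :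
    Real.exp (-T) + ∑ i, ∫ u in (π.quantile T i)..1, π.form i u = 1 := by
  refine le_antisymm ?_ ?_
  · rw [← π.prod_quantile hT]
    exact π.border_form_le _ fun i => π.quantile_mem hT i
  -- For the reverse inequality the product is expanded at the later time `t`, since `form` is at
  -- least `winProb t` above `quantile t`.
  have main := le_of_le_add_sq
    (h := fun s => -(∏ i, π.quantile s i + ∑ i, ∫ u in (π.quantile s i)..1, π.form i u))
    (C := 1) hT ?_
  · simp only [quantile_zero, π.prod_quantile hT] at main
    simp at main
    linarith
  intro s t hs hst _
  have ht := hs.trans hst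
  have h1 := abs_prod_sub_prod_sub_le Finset.univ (π.quantile t) (π.quantile s)
    (π.quantile_mem ht) (π.quantile_mem hs)
  have h2 : ∑ i, |π.quantile t i - π.quantile s i| ≤ t - s := by
    rw [← π.sum_sub hs hst]
    refine Finset.sum_le_sum fun i _ => ?_
    rw [abs_sub_comm]
    exact π.quantile_sub_le hs hst i
  have h3 : (∑ i, |π.quantile t i - π.quantile s i|) ^ 2 ≤ (t - s) ^ 2 :=
    pow_le_pow_left₀ (Finset.sum_nonneg fun i _ => abs_nonneg _) h2 2
  have h4 : ∑ i, (∫ u in (π.quantile s i)..1, π.form i u) ≤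
      ∑ i, (∫ u in (π.quantile t i)..1, π.form i u) +
      ∑ i, (π.quantile t i - π.quantile s i) *
        ∏ j ∈ Finset.univ.erase i, π.quantile t j := by
    rw [← Finset.sum_add_distrib]
    refine Finset.sum_le_sum fun i _ => ?_
    have hq := (π.quantile_le_iff ht hs i).2 hst
    rw [← intervalIntegral.integral_add_adjacent_intervals
      (π.form_intervalIntegrable i (π.quantile_le_one ht i) (π.quantile_le_one hs i))
      (π.form_intervalIntegrable i (π.quantile_le_one hs i) le_rfl), ← π.winProb_eq_prod ht]
    have h5 : (π.quantile s i - π.quantile t i) * π.winProb t i ≤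
        ∫ u in (π.quantile t i)..(π.quantile s i), π.form i u := by
      calc _ = ∫ u in (π.quantile t i)..(π.quantile s i), π.winProb t i := by simp
        _ ≤ _ := intervalIntegral.integral_mono_on hq (by simp)
          (π.form_intervalIntegrable i (π.quantile_le_one ht i) (π.quantile_le_one hs i))
          fun u hu => by
            rw [← π.form_quantile ht]
            exact π.form_mono i (π.quantile_le_one ht i)
              (hu.2.trans (π.quantile_le_one hs i)) hu.1
    linarith
  have h6 := abs_le.1 h1
  linarith [h6.2, h6.1]

end BorderPath

/-! ### Concave supermodular objectives and their demand. -/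

theorem continuousWithinAt_Ici_of_forall_exists {f : ℝ → ℝ} {u : ℝ} (hu : u ∈ Ico (0 : ℝ) 1)
    (hf : MonotoneOn f (Icc 0 1)) (h : ∀ r, f u < r → ∃ u', u < u' ∧ u' ≤ 1 ∧ f u' < r) :
    ContinuousWithinAt f (Ici u) u := by
  have hu' : u ∈ Icc (0 : ℝ) 1 := ⟨hu.1, hu.2.le⟩
  refine tendsto_order.2 ⟨fun a ha => ?_, fun r hr => ?_⟩
  · have h1 : Icc u 1 ∈ nhdsWithin u (Ici u) := Icc_mem_nhdsGE hu.2
    filter_upwards [h1] with x hx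
    exact ha.trans_le (hf hu' ⟨hu.1.trans hx.1, hx.2⟩ hx.1)
  · obtain ⟨u', h1, h2, h3⟩ := h r hr
    filter_upwards [Icc_mem_nhdsGE h1] with x hx
    exact (hf ⟨hu.1.trans hx.1, hx.2.trans h2⟩ ⟨hu.1.trans h1.le, h2⟩ hx.2).trans_lt h3

/-- `h` is a supergradient in `x` of the objective `H`, with the monotonicity of a concave
supermodular objective. -/
structure IsMarginal (H h : ℝ → ℝ → ℝ) : Prop where
  continuousOn : ContinuousOn (fun q : ℝ × ℝ => H q.1 q.2) (Icc 0 1 ×ˢ Icc 0 1)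
  continuousOn_marginal : ContinuousOn (fun q : ℝ × ℝ => h q.1 q.2) (Icc 0 1 ×ˢ Icc 0 1)
  anti : ∀ u ∈ Icc (0 : ℝ) 1, AntitoneOn (fun x => h x u) (Icc 0 1)
  mono : ∀ x ∈ Icc (0 : ℝ) 1, MonotoneOn (h x) (Icc 0 1)
  tangent : ∀ u ∈ Icc (0 : ℝ) 1, ∀ x ∈ Icc (0 : ℝ) 1, ∀ y ∈ Icc (0 : ℝ) 1,
    H y u - H x u ≤ h x u * (y - x)

/-- The largest maximizer of an objective with marginal `h`. -/
noncomputable def demand (h : ℝ → ℝ → ℝ) (u : ℝ) : ℝ :=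
  sSup {x | x ∈ Icc (0 : ℝ) 1 ∧ (x = 0 ∨ 0 ≤ h x u)}

theorem intervalIntegrable_of_monotoneOn {y : ℝ → ℝ} (hy : MonotoneOn y (Icc 0 1)) {a b : ℝ}
    (ha : a ∈ Icc (0 : ℝ) 1) (hb : b ∈ Icc (0 : ℝ) 1) :
    IntervalIntegrable y MeasureTheory.volume a b :=
  MonotoneOn.intervalIntegrable (hy.mono (uIcc_subset_Icc ha hb))

theorem IsCDF.intervalIntegrable {y : ℝ → ℝ} (hy : IsCDF y) {a b : ℝ}
    (ha : a ∈ Icc (0 : ℝ) 1) (hb : b ∈ Icc (0 : ℝ) 1) :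
    IntervalIntegrable y MeasureTheory.volume a b :=
  intervalIntegrable_of_monotoneOn hy.mono ha hb

theorem demand_bddAbove (h : ℝ → ℝ → ℝ) (u : ℝ) :
    BddAbove {x | x ∈ Icc (0 : ℝ) 1 ∧ (x = 0 ∨ 0 ≤ h x u)} :=
  ⟨1, fun _ hx => hx.1.2⟩

theorem demand_set_nonempty (h : ℝ → ℝ → ℝ) (u : ℝ) :
    {x | x ∈ Icc (0 : ℝ) 1 ∧ (x = 0 ∨ 0 ≤ h x u)}.Nonempty :=
  ⟨0, ⟨le_rfl, zero_le_one⟩, Or.inl rfl⟩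

theorem demand_mem (h : ℝ → ℝ → ℝ) (u : ℝ) : demand h u ∈ Icc (0 : ℝ) 1 :=
  ⟨le_csSup (demand_bddAbove h u) ⟨⟨le_rfl, zero_le_one⟩, Or.inl rfl⟩,
    csSup_le (demand_set_nonempty h u) fun _ hx => hx.1.2⟩

theorem le_demand {h : ℝ → ℝ → ℝ} {x u : ℝ} (hx : x ∈ Icc (0 : ℝ) 1) (hh : 0 ≤ h x u) :
    x ≤ demand h u :=
  le_csSup (demand_bddAbove h u) ⟨hx, Or.inr hh⟩

theorem neg_of_demand_lt {h : ℝ → ℝ → ℝ} {x u : ℝ} (hx : x ∈ Icc (0 : ℝ) 1)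
    (hh : demand h u < x) : h x u < 0 := by
  by_contra hcon
  exact absurd (le_demand hx (not_lt.1 hcon)) (not_le.2 hh)

namespace IsMarginal

variable {H h : ℝ → ℝ → ℝ} (hm : IsMarginal H h)

include hm

theorem continuousOn_left {u : ℝ} (hu : u ∈ Icc (0 : ℝ) 1) :
    ContinuousOn (fun x => h x u) (Icc 0 1) :=
  hm.continuousOn_marginal.comp (f := fun x : ℝ => (x, u)) (by fun_prop) fun _ hx => ⟨hx, hu⟩

theorem continuousOn_right {x : ℝ} (hx : x ∈ Icc (0 : ℝ) 1) : ContinuousOn (h x) (Icc 0 1) :=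
  hm.continuousOn_marginal.comp (f := fun u : ℝ => (x, u)) (by fun_prop) fun _ hu => ⟨hx, hu⟩

theorem demand_le {x u : ℝ} (hx : x ∈ Icc (0 : ℝ) 1) (hu : u ∈ Icc (0 : ℝ) 1)
    (hh : h x u < 0) : demand h u ≤ x := by
  refine csSup_le (demand_set_nonempty h u) fun z hz => ?_
  rcases hz.2 with rfl | h1
  · exact hx.1
  · by_contra hcon
    exact absurd (hm.anti u hu hx hz.1 (not_le.1 hcon).le) (not_le.2 (hh.trans_le h1))

/-- The marginal increases in the quantile, so the set over which the supremum is taken grows. -/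
theorem demand_mono : MonotoneOn (demand h) (Icc 0 1) := by
  intro u hu w hw huw
  refine csSup_le (demand_set_nonempty h u) fun z hz => ?_
  rcases hz.2 with rfl | h1
  · exact (demand_mem h w).1
  · exact le_demand hz.1 (h1.trans (hm.mono z hz.1 hu hw huw))

theorem marginal_demand_nonneg {u : ℝ} (hu : u ∈ Icc (0 : ℝ) 1) (hd : 0 < demand h u) :
    0 ≤ h (demand h u) u := by
  have hcl : IsClosed {x | x ∈ Icc (0 : ℝ) 1 ∧ (x = 0 ∨ 0 ≤ h x u)} := by
    have h1 : IsClosed (Icc (0 : ℝ) 1 ∩ (fun x => h x u) ⁻¹' Ici 0) :=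
      (hm.continuousOn_left hu).preimage_isClosed_of_isClosed isClosed_Icc isClosed_Ici
    have h2 : {x | x ∈ Icc (0 : ℝ) 1 ∧ (x = 0 ∨ 0 ≤ h x u)} =
        {0} ∪ (Icc (0 : ℝ) 1 ∩ (fun x => h x u) ⁻¹' Ici 0) := by
      ext x
      simp only [mem_ofPred_eq, mem_union, mem_singleton_iff, mem_inter_iff, mem_preimage, mem_Ici]
      constructor
      · rintro ⟨h3, h4 | h4⟩
        · exact Or.inl h4
        · exact Or.inr ⟨h3, h4⟩
      · rintro (rfl | h3)
        · exact ⟨⟨le_rfl, zero_le_one⟩, Or.inl rfl⟩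
        · exact ⟨h3.1, Or.inr h3.2⟩
    rw [h2]
    exact isClosed_singleton.union h1
  have hmem := hcl.csSup_mem (demand_set_nonempty h u) (demand_bddAbove h u)
  rcases hmem.2 with h0 | h0
  · exact absurd h0 hd.ne'
  · exact h0

theorem marginal_demand_nonpos {u : ℝ} (hu : u ∈ Icc (0 : ℝ) 1) (hd : demand h u < 1) :
    h (demand h u) u ≤ 0 := by
  have hc : ContinuousWithinAt (fun x => h x u) (Ioc (demand h u) 1) (demand h u) :=
    ((hm.continuousOn_left hu) _ (demand_mem h u)).mono fun x hx =>
      ⟨(demand_mem h u).1.trans hx.1.le, hx.2⟩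
  have hne : (nhdsWithin (demand h u) (Ioc (demand h u) 1)).NeBot := by
    rw [nhdsWithin_Ioc_eq_nhdsGT hd]; infer_instance
  refine le_of_tendsto hc ?_
  filter_upwards [self_mem_nhdsWithin] with x hx
  exact (neg_of_demand_lt ⟨(demand_mem h u).1.trans hx.1.le, hx.2⟩ hx.1).le

theorem demand_lt_of_lt {u r : ℝ} (hu : u ∈ Ico (0 : ℝ) 1) (hr : demand h u < r) :
    ∃ u', u < u' ∧ u' ≤ 1 ∧ demand h u' < r := by
  rcases lt_or_ge 1 r with h1 | h1
  · exact ⟨1, hu.2, le_rfl, (demand_mem h 1).2.trans_lt h1⟩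
  obtain ⟨x, hx1, hx2⟩ := exists_between hr
  have hx : x ∈ Icc (0 : ℝ) 1 := ⟨(demand_mem h u).1.trans hx1.le, hx2.le.trans h1⟩
  have hneg := neg_of_demand_lt hx hx1
  have hc : ContinuousWithinAt (h x) (Ioc u 1) u :=
    ((hm.continuousOn_right hx) u ⟨hu.1, hu.2.le⟩).mono fun w hw => ⟨hu.1.trans hw.1.le, hw.2⟩
  have hne : (nhdsWithin u (Ioc u 1)).NeBot := by
    rw [nhdsWithin_Ioc_eq_nhdsGT hu.2]; infer_instance
  obtain ⟨w, hw1, hw2⟩ := ((hc.eventually (gt_mem_nhds hneg)).and self_mem_nhdsWithin).exists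
  exact ⟨w, hw2.1, hw2.2,
    (hm.demand_le hx ⟨hu.1.trans hw2.1.le, hw2.2⟩ hw1).trans_lt hx2⟩

theorem intervalIntegrable_comp {y : ℝ → ℝ} (hy : IsCDF y) :
    IntervalIntegrable (fun u => H (y u) u) MeasureTheory.volume 0 1 := by
  let K : Set (ℝ × ℝ) := Icc 0 1 ×ˢ Icc 0 1
  have hcont := continuousOn_iff_continuous_domRestrict.1 hm.continuousOn
  have hcomp : IsCompact K := isCompact_Icc.prod isCompact_Icc
  obtain ⟨C, hC⟩ := hcomp.exists_bound_of_continuousOn hm.continuousOn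
  let P : ℝ → ℝ := fun u => (projIcc (0 : ℝ) 1 zero_le_one u : ℝ)
  have hP : ∀ u, P u ∈ Icc (0 : ℝ) 1 := fun u => (projIcc (0 : ℝ) 1 zero_le_one u).2
  have hPmono : Monotone P := fun a b hab => monotone_projIcc _ hab
  have hym : Monotone (fun u => y (P u)) := fun a b hab => hy.mono (hP a) (hP b) (hPmono hab)
  let φ : ℝ → K := fun u => ⟨(y (P u), P u), hy.mem _ (hP u), hP u⟩
  have hφ : Measurable φ :=
    (hym.measurable.prodMk hPmono.measurable).subtype_mk
  have hmeas : Measurable (fun u => H (y (P u)) (P u)) := hcont.measurable.comp hφ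
  have hint : MeasureTheory.IntegrableOn (fun u => H (y (P u)) (P u)) (Ioc 0 1) := by
    refine MeasureTheory.Measure.integrableOn_of_bounded (M := C) (by simp)
      hmeas.aestronglyMeasurable ?_
    exact Filter.Eventually.of_forall fun u => hC _ (φ u).2
  rw [intervalIntegrable_iff_integrableOn_Ioc_of_le zero_le_one]
  refine hint.congr_fun (fun u hu => ?_) measurableSet_Ioc
  have : P u = u := congrArg Subtype.val (projIcc_of_mem zero_le_one ⟨hu.1.le, hu.2⟩)
  simp only [this]

end IsMarginal

/-! ### Price paths and optimality of the truncated form. -/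

/-- Fubini applied to `P u = ∫_0^M 1{q ≤ P u} dq`. The weight `z` may change sign, hence the
integrability bookkeeping. -/
theorem layer_cake {P z : ℝ → ℝ} {M : ℝ} (hP : Measurable P) (hM : 0 ≤ M)
    (h0 : ∀ u ∈ Ioc (0 : ℝ) 1, 0 ≤ P u ∧ P u ≤ M)
    (hz : IntervalIntegrable z MeasureTheory.volume 0 1) :
    IntervalIntegrable (fun q => ∫ u in (0 : ℝ)..1, if q ≤ P u then z u else 0)
      MeasureTheory.volume 0 M ∧
    ∫ u in (0 : ℝ)..1, P u * z u =
      ∫ q in (0 : ℝ)..M, ∫ u in (0 : ℝ)..1, if q ≤ P u then z u else 0 := by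
  rw [intervalIntegrable_iff_integrableOn_Ioc_of_le zero_le_one] at hz
  rw [intervalIntegrable_iff_integrableOn_Ioc_of_le hM, intervalIntegral.integral_of_le hM]
  simp only [intervalIntegral.integral_of_le (zero_le_one' ℝ)]
  set μ := MeasureTheory.volume.restrict (Ioc (0 : ℝ) 1)
  set ν := MeasureTheory.volume.restrict (Ioc (0 : ℝ) M)
  have hS : MeasurableSet {a : ℝ × ℝ | a.1 ≤ P a.2} :=
    measurableSet_le measurable_fst (hP.comp measurable_snd)
  have hint : MeasureTheory.Integrable
      (fun a : ℝ × ℝ => if a.1 ≤ P a.2 then z a.2 else 0) (ν.prod μ) := by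
    have h1 : MeasureTheory.Integrable (fun a : ℝ × ℝ => z a.2) (ν.prod μ) := hz.comp_snd ν
    exact h1.indicator hS
  refine ⟨hint.integral_prod_left, ?_⟩
  rw [MeasureTheory.integral_integral_swap hint]
  refine MeasureTheory.setIntegral_congr_fun measurableSet_Ioc fun u hu => ?_
  obtain ⟨h1, h2⟩ := h0 u hu
  have h3 : (fun q => if q ≤ P u then z u else 0) = (Iic (P u)).indicator fun _ => z u := by
    ext q; simp [indicator]
  simp only [h3]
  rw [MeasureTheory.integral_indicator measurableSet_Iic, MeasureTheory.Measure.restrict_restrict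
    measurableSet_Iic]
  have h4 : Iic (P u) ∩ Ioc 0 M = Ioc 0 (P u) := by
    ext q; simp only [mem_inter_iff, mem_Iic, mem_Ioc]
    constructor
    · rintro ⟨a, b, c⟩; exact ⟨b, a⟩
    · rintro ⟨a, b⟩; exact ⟨b, a, b.trans h2⟩
  rw [h4]
  simp [h1]

theorem BorderPath.exists_gt_le_quantile {n : ℕ} (π : BorderPath n) {i : Fin n} {t u : ℝ}
    (ht : 0 ≤ t) (hu : u < π.quantile t i) : ∃ s, t < s ∧ u ≤ π.quantile s i := by
  rcases le_total u (π.quantile (t + 1) i) with h1 | h1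
  · exact ⟨t + 1, by linarith, h1⟩
  · obtain ⟨s, hs0, _, rfl⟩ := π.exists_quantile_eq (hu.le.trans (π.quantile_le_one ht i)) i
      (by linarith : 0 ≤ t + 1) h1
    exact ⟨s, (π.quantile_lt_iff hs0 ht i).1 hu, le_rfl⟩

/-- A path along which the marginals of all bidders agree, the common value `p` being strictly
decreasing. -/
structure PricePath {n : ℕ} (H h : Fin n → ℝ → ℝ → ℝ) extends BorderPath n where
  p : ℝ → ℝ
  marginal : ∀ i, IsMarginal (H i) (h i)
  anti : StrictAntiOn p (Ici 0)
  foc : ∀ t, 0 ≤ t → ∀ i, h i (toBorderPath.winProb t i) (toBorderPath.quantile t i) = p t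
  p_zero_pos : 0 < p 0

namespace PricePath

variable {n : ℕ} {H h : Fin n → ℝ → ℝ → ℝ} (π : PricePath H h)

/-- The nonnegative part of the path price at the time at which bidder `i` has quantile `u`. -/
noncomputable def price (i : Fin n) (u : ℝ) : ℝ :=
  sInf ((fun t => max (π.p t) 0) '' {t | 0 ≤ t ∧ u ≤ π.quantile t i})

/-- The reduced form of the path, cut off where the marginal is negative. -/
noncomputable def optForm (i : Fin n) (u : ℝ) : ℝ := min (π.form i u) (demand (h i) u)

theorem p_anti {s t : ℝ} (hs : 0 ≤ s) (hst : s ≤ t) : π.p t ≤ π.p s :=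
  π.anti.antitoneOn hs (hs.trans hst : (0 : ℝ) ≤ t) hst

theorem p_continuousOn (i : Fin n) : ContinuousOn π.p (Ici 0) := by
  have h1 : ContinuousOn (fun t => h i (π.winProb t i) (π.quantile t i)) (Ici 0) :=
    (π.marginal i).continuousOn_marginal.comp (f := fun t => (π.winProb t i, π.quantile t i))
      ((π.winProb_continuousOn i).prodMk (π.quantile_continuousOn i))
      fun t ht => ⟨π.winProb_mem ht i, π.quantile_mem ht i⟩
  exact h1.congr fun t ht => (π.foc t ht i).symm

theorem price_bddBelow (i : Fin n) (u : ℝ) :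
    BddBelow ((fun t => max (π.p t) 0) '' {t | 0 ≤ t ∧ u ≤ π.quantile t i}) :=
  ⟨0, by rintro _ ⟨t, _, rfl⟩; exact le_max_right _ _⟩

theorem price_nonneg (i : Fin n) (u : ℝ) : 0 ≤ π.price i u :=
  Real.sInf_nonneg (by rintro _ ⟨t, _, rfl⟩; exact le_max_right _ _)

theorem price_le {i : Fin n} {u t : ℝ} (ht : 0 ≤ t) (hu : u ≤ π.quantile t i) :
    π.price i u ≤ max (π.p t) 0 :=
  csInf_le (π.price_bddBelow i u) ⟨t, ⟨ht, hu⟩, rfl⟩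

theorem le_price {i : Fin n} {u c : ℝ} (hu : u ≤ 1)
    (hc : ∀ t, 0 ≤ t → u ≤ π.quantile t i → c ≤ max (π.p t) 0) : c ≤ π.price i u :=
  le_csInf ⟨_, 0, ⟨le_rfl, by rwa [π.quantile_zero]⟩, rfl⟩
    (by rintro _ ⟨t, ht, rfl⟩; exact hc t ht.1 ht.2)

theorem price_le_p_zero {i : Fin n} {u : ℝ} (hu : u ≤ 1) : π.price i u ≤ π.p 0 :=
  (π.price_le le_rfl (by rwa [π.quantile_zero])).trans_eq (max_eq_left π.p_zero_pos.le)

theorem price_mono (i : Fin n) : MonotoneOn (π.price i) (Iic 1) := fun _ _ _ hb hab =>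
  π.le_price hb fun _ ht hbt => π.price_le ht (hab.trans hbt)

theorem price_quantile {t : ℝ} (ht : 0 ≤ t) (i : Fin n) :
    π.price i (π.quantile t i) = max (π.p t) 0 :=
  le_antisymm (π.price_le ht le_rfl) (π.le_price (π.quantile_le_one ht i) fun _ hs hq =>
    max_le_max (π.p_anti hs ((π.quantile_le_iff ht hs i).1 hq)) le_rfl)

/-- Superlevel sets of the price are quantile intervals ending at 1, which turns layers into Border
constraints. Positivity of `p t` is essential because the price is truncated at zero. -/
theorem p_le_price_iff {i : Fin n} {t u : ℝ} (ht : 0 ≤ t) (hp : 0 < π.p t) (hu : u ≤ 1) :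
    π.p t ≤ π.price i u ↔ π.quantile t i ≤ u := by
  constructor
  · intro hle
    by_contra hcon
    push Not at hcon
    obtain ⟨s, hts, hs⟩ := π.exists_gt_le_quantile ht hcon
    have h2 := π.price_le (ht.trans hts.le) hs
    have h3 : max (π.p s) 0 < π.p t := max_lt (π.anti ht (ht.trans hts.le : (0 : ℝ) ≤ s) hts) hp
    linarith
  · intro hq
    refine π.le_price hu fun s hs hus => le_max_of_le_left ?_
    exact π.p_anti hs ((π.quantile_le_iff ht hs i).1 (hq.trans hus))

theorem optForm_le_form (i : Fin n) (u : ℝ) : π.optForm i u ≤ π.form i u := min_le_left _ _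

/-- The marginal along the path is the path price, so demand does not bind while that price is
nonnegative. -/
theorem optForm_eq_form {i : Fin n} {t u : ℝ} (ht : 0 ≤ t) (hp : 0 ≤ π.p t)
    (hu : u ∈ Icc (π.quantile t i) 1) : π.optForm i u = π.form i u := by
  obtain ⟨s, hs0, hst, rfl⟩ := π.exists_quantile_eq hu.2 i ht hu.1
  refine min_eq_left ?_
  rw [π.form_quantile hs0]
  refine le_demand (π.winProb_mem hs0 i) ?_
  rw [π.foc s hs0 i]
  exact hp.trans (π.p_anti hs0 hst)

theorem optForm_isCDF (i : Fin n) : IsCDF (π.optForm i) where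
  mem u hu := ⟨le_min (π.form_nonneg i u) (demand_mem (h i) u).1,
    (min_le_right _ _).trans (demand_mem (h i) u).2⟩
  mono u hu w hw huw := min_le_min (π.form_mono i hu.2 hw.2 huw)
    ((π.marginal i).demand_mono hu hw huw)
  rightCont u hu := by
    have h1 : ContinuousWithinAt (π.form i) (Ici u) u :=
      continuousWithinAt_Ici_of_forall_exists hu ((π.form_mono i).mono fun _ hx => hx.2)
        fun r hr => π.form_lt_of_lt hu.2 hr
    have h2 : ContinuousWithinAt (demand (h i)) (Ici u) u :=
      continuousWithinAt_Ici_of_forall_exists hu (π.marginal i).demand_mono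
        fun r hr => (π.marginal i).demand_lt_of_lt hu hr
    exact h1.min h2
  one := by
    rw [π.optForm_eq_form le_rfl π.p_zero_pos.le ⟨(π.quantile_zero i).le, le_rfl⟩, π.form_one]

theorem optForm_isFeasible : IsFeasible π.optForm := by
  refine ⟨π.optForm_isCDF, fun w hw => le_trans ?_ (π.border_form_le w hw)⟩
  gcongr with i
  exact intervalIntegral.integral_mono_on (hw i).2
    ((π.optForm_isCDF i).intervalIntegrable (hw i) ⟨zero_le_one, le_rfl⟩)
    (π.form_intervalIntegrable i (hw i).2 le_rfl) fun u _ => π.optForm_le_form i u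

/-- Below all path quantiles, `winProb` tends to 0 while the quantiles accumulate at some `w ≥ u`.
By continuity `h i 0 w` is a limit of path prices, and `h i 0 u ≤ h i 0 w`. -/
theorem marginal_zero_le_price {i : Fin n} {u : ℝ} (hu : u ∈ Ioc (0 : ℝ) 1)
    (hlt : ∀ t, 0 ≤ t → u ≤ π.quantile t i) : h i 0 u ≤ π.price i u := by
  have hm := π.marginal i
  obtain ⟨w, hw, φ, hφ, hlim⟩ := isCompact_Icc.tendsto_subseq
    (x := fun l : ℕ => π.quantile l i) (s := Icc (0 : ℝ) 1)
    fun l => π.quantile_mem (Nat.cast_nonneg l) i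
  have huw : u ≤ w := ge_of_tendsto' hlim fun l => hlt _ (Nat.cast_nonneg _)
  have hφ' : Filter.Tendsto (fun l => ((φ l : ℕ) : ℝ)) Filter.atTop Filter.atTop :=
    tendsto_natCast_atTop_atTop.comp hφ.tendsto_atTop
  have hwin : Filter.Tendsto (fun l => π.winProb (φ l) i) Filter.atTop (nhds 0) := by
    have h1 : Filter.Tendsto (fun l => Real.exp (-((φ l : ℕ) : ℝ)) / u) Filter.atTop
        (nhds (0 / u)) := (Real.tendsto_exp_neg_atTop_nhds_zero.comp hφ').div_const u
    rw [zero_div] at h1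
    refine squeeze_zero (fun l => (π.winProb_pos _ i).le) (fun l => ?_) h1
    rw [le_div_iff₀ hu.1, mul_comm]
    exact π.winProb_mul_le (hlt _ (Nat.cast_nonneg _))
  have h0 : (0 : ℝ) ∈ Icc (0 : ℝ) 1 := ⟨le_rfl, zero_le_one⟩
  have hcomb : Filter.Tendsto (fun l => (π.winProb (φ l) i, π.quantile (φ l) i)) Filter.atTop
      (nhdsWithin (0, w) (Icc 0 1 ×ˢ Icc 0 1)) := by
    refine tendsto_nhdsWithin_iff.2 ⟨hwin.prodMk_nhds hlim, Filter.Eventually.of_forall fun l => ?_⟩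
    exact ⟨π.winProb_mem (Nat.cast_nonneg _) i, π.quantile_mem (Nat.cast_nonneg _) i⟩
  have hh := (hm.continuousOn_marginal (0, w) ⟨h0, hw⟩).tendsto.comp hcomb
  refine π.le_price hu.2 fun t ht _ => le_max_of_le_left ?_
  refine (hm.mono 0 h0 ⟨hu.1.le, hu.2⟩ hw huw).trans ?_
  refine le_of_tendsto hh ?_
  filter_upwards [hφ'.eventually_ge_atTop t] with l hl
  simp only [Function.comp]
  rw [π.foc _ (ht.trans hl) i]
  exact π.p_anti ht hl

theorem optForm_maximizes {i : Fin n} {u y : ℝ} (hu : u ∈ Ioc (0 : ℝ) 1)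
    (hy : y ∈ Icc (0 : ℝ) 1) :
    H i y u - π.price i u * y ≤ H i (π.optForm i u) u - π.price i u * π.optForm i u := by
  have hm := π.marginal i
  have hu' : u ∈ Icc (0 : ℝ) 1 := ⟨hu.1.le, hu.2⟩
  have hx := (π.optForm_isCDF i).mem u hu'
  have htan := hm.tangent u hu' _ hx y hy
  -- By concavity only the first-order condition is needed. There are three cases: a reached
  -- quantile with nonnegative price (equality), one with negative price (demand binds), and an
  -- unreached quantile (the form is 0).
  suffices (h i (π.optForm i u) u - π.price i u) * (y - π.optForm i u) ≤ 0 by nlinarith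
  by_cases hex : ∃ t, 0 ≤ t ∧ π.quantile t i ≤ u
  · obtain ⟨t', ht', hq⟩ := hex
    obtain ⟨t, ht, _, rfl⟩ := π.exists_quantile_eq hu.2 i ht' hq
    rcases le_or_gt 0 (π.p t) with hp | hp
    · rw [π.optForm_eq_form ht hp ⟨le_rfl, π.quantile_le_one ht i⟩, π.form_quantile ht,
        π.foc t ht i, π.price_quantile ht, max_eq_left hp]
      simp
    · have hneg : h i (π.winProb t i) (π.quantile t i) < 0 := by rw [π.foc t ht i]; exact hp
      have hd := hm.demand_le (π.winProb_mem ht i) hu' hneg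
      have hlt : demand (h i) (π.quantile t i) < π.winProb t i := by
        refine lt_of_le_of_ne hd fun heq => ?_
        have h1 := hm.marginal_demand_nonneg hu' (by rw [heq]; exact π.winProb_pos t i)
        rw [heq] at h1
        linarith
      have hopt : π.optForm i (π.quantile t i) = demand (h i) (π.quantile t i) := by
        rw [optForm, π.form_quantile ht]; exact min_eq_right hd
      rw [hopt, π.price_quantile ht, max_eq_right hp.le, sub_zero]
      have hnp := hm.marginal_demand_nonpos hu' (hlt.trans_le (π.winProb_le_one ht i))
      rcases (demand_mem (h i) (π.quantile t i)).1.eq_or_lt with h0 | h0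
      · rw [← h0] at hnp ⊢
        exact mul_nonpos_of_nonpos_of_nonneg hnp (by linarith [hy.1])
      · have hnn := hm.marginal_demand_nonneg hu' h0
        rw [le_antisymm hnp hnn]; simp
  · push Not at hex
    have hlt : ∀ t, 0 ≤ t → u ≤ π.quantile t i := fun t ht => (hex t ht).le
    have h0 : π.optForm i u = 0 := π.eq_zero_of_forall_le hu.1 hx.1 fun t ht =>
      ⟨hlt t ht, (π.optForm_le_form i u).trans (π.form_le ht (hlt t ht))⟩
    rw [h0]
    have := π.marginal_zero_le_price hu hlt
    exact mul_nonpos_of_nonpos_of_nonneg (by linarith) (by linarith [hy.1])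

/-- The Border slack of `y` relative to `optForm`, above the quantiles at which the price is `q`. -/
noncomputable def slack (y : Fin n → ℝ → ℝ) (q : ℝ) : ℝ :=
  ∑ i, ∫ u in (0 : ℝ)..1, if q ≤ π.price i u then π.optForm i u - y i u else 0

variable {y : Fin n → ℝ → ℝ}

theorem sub_intervalIntegrable (hy : IsFeasible y) (i : Fin n) {a b : ℝ}
    (ha : a ∈ Icc (0 : ℝ) 1) (hb : b ∈ Icc (0 : ℝ) 1) :
    IntervalIntegrable (fun u => π.optForm i u - y i u) MeasureTheory.volume a b :=
  ((π.optForm_isCDF i).intervalIntegrable ha hb).sub ((hy.1 i).intervalIntegrable ha hb)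

theorem slack_p {t : ℝ} (ht : 0 ≤ t) (hp : 0 < π.p t) :
    π.slack y (π.p t) = ∑ i, ∫ u in (π.quantile t i)..1, (π.optForm i u - y i u) := by
  refine Finset.sum_congr rfl fun i _ => ?_
  have hq := π.quantile_mem ht i
  have hq0 := π.quantile_pos t i
  have key : ∀ u ∈ Ioc (0 : ℝ) 1, (if π.p t ≤ π.price i u then π.optForm i u - y i u else 0) =
      (Ici (π.quantile t i)).indicator (fun u => π.optForm i u - y i u) u := by
    intro u hu
    simp only [π.p_le_price_iff ht hp hu.2, indicator, mem_Ici]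
  rw [intervalIntegral.integral_of_le zero_le_one, intervalIntegral.integral_of_le hq.2,
    MeasureTheory.setIntegral_congr_fun measurableSet_Ioc key,
    MeasureTheory.integral_indicator measurableSet_Ici,
    MeasureTheory.Measure.restrict_restrict measurableSet_Ici,
    ← MeasureTheory.integral_Icc_eq_integral_Ioc]
  congr 2
  ext u
  simp only [mem_inter_iff, mem_Ici, mem_Ioc, mem_Icc]
  constructor
  · rintro ⟨a, b, c⟩; exact ⟨a, c⟩
  · rintro ⟨a, b⟩; exact ⟨a, hq0.trans_le a, b⟩

theorem border_optForm_eq {t : ℝ} (ht : 0 ≤ t) (hp : 0 ≤ π.p t) :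
    Real.exp (-t) + ∑ i, ∫ u in (π.quantile t i)..1, π.optForm i u = 1 := by
  refine Eq.trans ?_ (π.border_form_eq ht)
  rw [add_right_inj]
  refine Finset.sum_congr rfl fun i _ => intervalIntegral.integral_congr fun u hu => ?_
  rw [uIcc_of_le (π.quantile_le_one ht i)] at hu
  exact π.optForm_eq_form ht hp hu

theorem sum_integral_sub {t : ℝ} (hy : IsFeasible y) (ht : 0 ≤ t) (hp : 0 ≤ π.p t) :
    ∑ i, ∫ u in (π.quantile t i)..1, (π.optForm i u - y i u) =
      1 - (∏ i, π.quantile t i + ∑ i, ∫ u in (π.quantile t i)..1, y i u) := by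
  have h1 : ∀ i, ∫ u in (π.quantile t i)..1, (π.optForm i u - y i u) =
      (∫ u in (π.quantile t i)..1, π.optForm i u) - ∫ u in (π.quantile t i)..1, y i u :=
    fun i => intervalIntegral.integral_sub
      ((π.optForm_isCDF i).intervalIntegrable (π.quantile_mem ht i) ⟨zero_le_one, le_rfl⟩)
      ((hy.1 i).intervalIntegrable (π.quantile_mem ht i) ⟨zero_le_one, le_rfl⟩)
  simp only [h1, Finset.sum_sub_distrib]
  have := π.border_optForm_eq ht hp
  rw [π.prod_quantile ht]
  linarith

theorem sum_integral_sub_nonneg {t : ℝ} (hy : IsFeasible y) (ht : 0 ≤ t) (hp : 0 ≤ π.p t) :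
    0 ≤ ∑ i, ∫ u in (π.quantile t i)..1, (π.optForm i u - y i u) := by
  rw [π.sum_integral_sub hy ht hp]
  linarith [hy.2 _ (π.quantile_mem ht)]

theorem slack_nonneg (hy : IsFeasible y) {q : ℝ} (hq : q ∈ Ioc 0 (π.p 0)) :
    0 ≤ π.slack y q := by
  rcases isEmpty_or_nonempty (Fin n) with hn | ⟨⟨i₀⟩⟩
  · simp [slack]
  -- A price below every `p t` has all of `[0, 1]` as superlevel set. There the total of `optForm`
  -- is at least 1, by letting `t` tend to infinity in the binding constraints, and the total of `y`
  -- is at most 1.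
  by_cases hex : ∃ t, 0 ≤ t ∧ π.p t ≤ q
  · obtain ⟨t, ht, hpt⟩ := hex
    obtain ⟨s, hs, rfl⟩ := intermediate_value_Icc' ht
      ((π.p_continuousOn i₀).mono fun s hs => hs.1) ⟨hpt, hq.2⟩
    rw [π.slack_p hs.1 hq.1]
    exact π.sum_integral_sub_nonneg hy hs.1 hq.1.le
  · push Not at hex
    have hI : (0 : ℝ) ∈ Icc (0 : ℝ) 1 := ⟨le_rfl, zero_le_one⟩
    have hI1 : (1 : ℝ) ∈ Icc (0 : ℝ) 1 := ⟨zero_le_one, le_rfl⟩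
    have h1 : π.slack y q = ∑ i, ∫ u in (0 : ℝ)..1, (π.optForm i u - y i u) := by
      refine Finset.sum_congr rfl fun i _ => intervalIntegral.integral_congr fun u hu => ?_
      rw [uIcc_of_le zero_le_one] at hu
      have : q ≤ π.price i u :=
        π.le_price hu.2 fun t ht _ => le_max_of_le_left (hex t ht).le
      simp [this]
    have h2 : ∀ i, ∫ u in (0 : ℝ)..1, (π.optForm i u - y i u) =
        (∫ u in (0 : ℝ)..1, π.optForm i u) - ∫ u in (0 : ℝ)..1, y i u :=
      fun i => intervalIntegral.integral_sub ((π.optForm_isCDF i).intervalIntegrable hI hI1)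
        ((hy.1 i).intervalIntegrable hI hI1)
    have h3 : ∑ i, ∫ u in (0 : ℝ)..1, y i u ≤ 1 := by
      have := hy.2 (fun _ => 0) fun _ => hI
      have hprod : ∏ _i : Fin n, (0 : ℝ) = 0 := Finset.prod_eq_zero (Finset.mem_univ i₀) rfl
      rw [hprod] at this
      linarith
    have h4 : 1 ≤ ∑ i, ∫ u in (0 : ℝ)..1, π.optForm i u := by
      have h5 : ∀ᶠ t in Filter.atTop,
          1 - Real.exp (-t) ≤ ∑ i, ∫ u in (0 : ℝ)..1, π.optForm i u := by
        filter_upwards [Filter.eventually_ge_atTop 0] with t ht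
        have h6 := π.border_optForm_eq ht (hq.1.le.trans (hex t ht).le)
        have h7 : ∑ i, (∫ u in (π.quantile t i)..1, π.optForm i u) ≤
            ∑ i, ∫ u in (0 : ℝ)..1, π.optForm i u := by
          refine Finset.sum_le_sum fun i _ => ?_
          rw [← intervalIntegral.integral_add_adjacent_intervals
            ((π.optForm_isCDF i).intervalIntegrable hI (π.quantile_mem ht i))
            ((π.optForm_isCDF i).intervalIntegrable (π.quantile_mem ht i) hI1)]
          have : 0 ≤ ∫ u in (0 : ℝ)..(π.quantile t i), π.optForm i u :=
            intervalIntegral.integral_nonneg (π.quantile_mem ht i).1 fun u hu =>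
              ((π.optForm_isCDF i).mem u ⟨hu.1, hu.2.trans (π.quantile_le_one ht i)⟩).1
          linarith
        linarith
      have lim := (Real.tendsto_exp_neg_atTop_nhds_zero).const_sub 1
      simpa using le_of_tendsto lim h5
    rw [h1]
    simp only [h2, Finset.sum_sub_distrib]
    linarith

/-- The loss of `y` in the price-adjusted objective of bidder `i` at quantile `u`. -/
noncomputable def loss (y : Fin n → ℝ → ℝ) (i : Fin n) (u : ℝ) : ℝ :=
  H i (π.optForm i u) u - H i (y i u) u - π.price i u * (π.optForm i u - y i u)

theorem loss_nonneg (hy : IsFeasible y) (i : Fin n) {u : ℝ} (hu : u ∈ Ioc (0 : ℝ) 1) :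
    0 ≤ π.loss y i u := by
  have := π.optForm_maximizes (i := i) hu ((hy.1 i).mem u ⟨hu.1.le, hu.2⟩)
  rw [loss]
  linarith

theorem price_mul_layer (hy : IsFeasible y) (i : Fin n) :
    IntervalIntegrable (fun q => ∫ u in (0 : ℝ)..1,
      if q ≤ π.price i u then π.optForm i u - y i u else 0) MeasureTheory.volume 0 (π.p 0) ∧
    IntervalIntegrable (fun u => π.price i u * (π.optForm i u - y i u))
      MeasureTheory.volume 0 1 ∧
    ∫ u in (0 : ℝ)..1, π.price i u * (π.optForm i u - y i u) = ∫ q in (0 : ℝ)..(π.p 0),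
      ∫ u in (0 : ℝ)..1, if q ≤ π.price i u then π.optForm i u - y i u else 0 := by
  have hI : (0 : ℝ) ∈ Icc (0 : ℝ) 1 := ⟨le_rfl, zero_le_one⟩
  have hI1 : (1 : ℝ) ∈ Icc (0 : ℝ) 1 := ⟨zero_le_one, le_rfl⟩
  let P : ℝ → ℝ := fun u => π.price i (min u 1)
  have hP : Monotone P := fun a b hab =>
    π.price_mono i (min_le_right a 1) (min_le_right b 1) (min_le_min hab le_rfl)
  have hPe : ∀ u ∈ uIcc (0 : ℝ) 1, P u = π.price i u := fun u hu => by
    rw [uIcc_of_le zero_le_one] at hu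
    simp only [P, min_eq_left hu.2]
  have hz := π.sub_intervalIntegrable hy i hI hI1
  obtain ⟨h1, h2⟩ := layer_cake hP.measurable π.p_zero_pos.le
    (fun u hu => ⟨π.price_nonneg i _, π.price_le_p_zero (min_le_right u 1)⟩) hz
  have h3 : ∀ q, (∫ u in (0 : ℝ)..1, if q ≤ P u then π.optForm i u - y i u else 0) =
      ∫ u in (0 : ℝ)..1, if q ≤ π.price i u then π.optForm i u - y i u else 0 := fun q =>
    intervalIntegral.integral_congr fun u hu => by simp only [hPe u hu]
  simp only [h3] at h1 h2
  refine ⟨h1, ?_, ?_⟩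
  · rw [intervalIntegrable_iff_integrableOn_Ioc_of_le zero_le_one] at hz ⊢
    refine hz.bdd_mul (c := π.p 0) ?_ ?_
    · refine (hP.measurable.aestronglyMeasurable (μ := MeasureTheory.volume.restrict
        (Ioc (0 : ℝ) 1))).congr ?_
      filter_upwards [MeasureTheory.ae_restrict_mem measurableSet_Ioc] with u hu
      exact hPe u (by rw [uIcc_of_le zero_le_one]; exact ⟨hu.1.le, hu.2⟩)
    · filter_upwards [MeasureTheory.ae_restrict_mem measurableSet_Ioc] with u hu
      rw [Real.norm_of_nonneg (π.price_nonneg i u)]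
      exact π.price_le_p_zero hu.2
  · rw [← h2]
    exact intervalIntegral.integral_congr fun u hu => by simp only [hPe u hu]

theorem loss_intervalIntegrable (hy : IsFeasible y) (i : Fin n) :
    IntervalIntegrable (π.loss y i) MeasureTheory.volume 0 1 :=
  (((π.marginal i).intervalIntegrable_comp (π.optForm_isCDF i)).sub
    ((π.marginal i).intervalIntegrable_comp (hy.1 i))).sub (π.price_mul_layer hy i).2.1

theorem slack_intervalIntegrable (hy : IsFeasible y) :
    IntervalIntegrable (π.slack y) MeasureTheory.volume 0 (π.p 0) := by
  have := IntervalIntegrable.sum Finset.univ fun i (_ : i ∈ Finset.univ) =>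
    (π.price_mul_layer hy i).1
  have heq : π.slack y = ∑ i, fun q => ∫ u in (0 : ℝ)..1,
      if q ≤ π.price i u then π.optForm i u - y i u else 0 := by
    funext q
    simp [slack, Finset.sum_apply]
  rwa [heq]

theorem revenue_sub (hy : IsFeasible y) :
    revenue H π.optForm - revenue H y =
      ∑ i, (∫ u in (0 : ℝ)..1, π.loss y i u) + ∫ q in (0 : ℝ)..(π.p 0), π.slack y q := by
  have h1 : ∫ q in (0 : ℝ)..(π.p 0), π.slack y q =
      ∑ i, ∫ u in (0 : ℝ)..1, π.price i u * (π.optForm i u - y i u) := by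
    simp only [slack]
    rw [intervalIntegral.integral_finsetSum fun i _ => (π.price_mul_layer hy i).1]
    exact Finset.sum_congr rfl fun i _ => (π.price_mul_layer hy i).2.2.symm
  rw [h1, revenue, revenue, ← Finset.sum_sub_distrib, ← Finset.sum_add_distrib]
  refine Finset.sum_congr rfl fun i _ => ?_
  have hA := (π.marginal i).intervalIntegrable_comp (π.optForm_isCDF i)
  have hB := (π.marginal i).intervalIntegrable_comp (hy.1 i)
  simp only [loss]
  rw [intervalIntegral.integral_sub (hA.sub hB) (π.price_mul_layer hy i).2.1,
    intervalIntegral.integral_sub hA hB]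
  ring

theorem integral_loss_nonneg (hy : IsFeasible y) (i : Fin n) :
    0 ≤ ∫ u in (0 : ℝ)..1, π.loss y i u := by
  rw [intervalIntegral.integral_of_le zero_le_one]
  exact MeasureTheory.setIntegral_nonneg measurableSet_Ioc fun u hu => π.loss_nonneg hy i hu

theorem integral_slack_nonneg (hy : IsFeasible y) :
    0 ≤ ∫ q in (0 : ℝ)..(π.p 0), π.slack y q := by
  rw [intervalIntegral.integral_of_le π.p_zero_pos.le]
  exact MeasureTheory.setIntegral_nonneg measurableSet_Ioc fun q hq => π.slack_nonneg hy hq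

theorem optForm_isOptimal : IsOptimal H π.optForm := by
  refine ⟨π.optForm_isFeasible, fun y hy => ?_⟩
  have h1 := π.revenue_sub hy
  have h2 := π.integral_slack_nonneg hy
  have h3 := Finset.sum_nonneg fun i (_ : i ∈ Finset.univ) => π.integral_loss_nonneg hy i
  linarith

/-! ### What every optimal reduced form satisfies. -/

theorem integrals_eq_zero (hy : IsOptimal H y) :
    (∀ i, ∫ u in (0 : ℝ)..1, π.loss y i u = 0) ∧ ∫ q in (0 : ℝ)..(π.p 0), π.slack y q = 0 := by
  have h1 := π.revenue_sub hy.1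
  have h2 := π.integral_slack_nonneg hy.1
  have h3 := fun i => π.integral_loss_nonneg hy.1 i
  have h4 := Finset.sum_nonneg fun i (_ : i ∈ Finset.univ) => h3 i
  have h5 := hy.2 _ π.optForm_isFeasible
  have h6 : ∑ i, (∫ u in (0 : ℝ)..1, π.loss y i u) = 0 := by linarith
  refine ⟨fun i => ?_, by linarith⟩
  exact (Finset.sum_eq_zero_iff_of_nonneg fun i _ => h3 i).1 h6 i (Finset.mem_univ i)

theorem exists_of_integral_eq_zero {f : ℝ → ℝ} {M a b : ℝ} (hM : 0 ≤ M)
    (hf : IntervalIntegrable f MeasureTheory.volume 0 M) (h0 : ∀ x ∈ Ioc 0 M, 0 ≤ f x)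
    (hint : ∫ x in (0 : ℝ)..M, f x = 0) (ha : 0 ≤ a) (hab : a < b) (hb : b ≤ M) :
    ∃ x ∈ Ioo a b, f x = 0 := by
  rw [intervalIntegral.integral_of_le hM] at hint
  rw [intervalIntegrable_iff_integrableOn_Ioc_of_le hM] at hf
  have h1 := (MeasureTheory.setIntegral_eq_zero_iff_of_nonneg_ae
    ((MeasureTheory.ae_restrict_mem measurableSet_Ioc).mono h0) hf).1 hint
  have h2 : ∀ᵐ x ∂(MeasureTheory.volume.restrict (Ioo a b)), f x = 0 :=
    MeasureTheory.ae_restrict_of_ae_restrict_of_subset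
      (fun x (hx : x ∈ Ioo a b) => (⟨ha.trans_lt hx.1, hx.2.le.trans hb⟩ : x ∈ Ioc 0 M)) h1
  have hne : (MeasureTheory.ae (MeasureTheory.volume.restrict (Ioo a b))).NeBot := by
    rw [MeasureTheory.ae_neBot, Ne, MeasureTheory.Measure.restrict_eq_zero]
    simp [hab]
  obtain ⟨x, hx1, hx2⟩ :=
    (h2.and (MeasureTheory.ae_restrict_mem measurableSet_Ioo)).exists
  exact ⟨x, hx2, hx1⟩

theorem exists_loss_eq_zero (hy : IsOptimal H y) (i : Fin n) {a b : ℝ} (ha : 0 ≤ a)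
    (hab : a < b) (hb : b ≤ 1) : ∃ u ∈ Ioo a b, π.loss y i u = 0 :=
  exists_of_integral_eq_zero zero_le_one (π.loss_intervalIntegrable hy.1 i)
    (fun _ hu => π.loss_nonneg hy.1 i hu) ((π.integrals_eq_zero hy).1 i) ha hab hb

theorem border_eq (hy : IsOptimal H y) {t : ℝ} (ht : 0 ≤ t) (hp : 0 ≤ π.p t) :
    ∏ i, π.quantile t i + ∑ i, ∫ u in (π.quantile t i)..1, y i u = 1 := by
  rcases isEmpty_or_nonempty (Fin n) with hn | ⟨⟨i₀⟩⟩
  · simp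
  suffices hD : ∑ i, ∫ u in (π.quantile t i)..1, (π.optForm i u - y i u) = 0 by
    rw [π.sum_integral_sub hy.1 ht hp] at hD; linarith
  rcases ht.eq_or_lt with rfl | ht'
  · simp [π.quantile_zero]
  have hI : (0 : ℝ) ∈ Icc (0 : ℝ) 1 := ⟨le_rfl, zero_le_one⟩
  have hI1 : (1 : ℝ) ∈ Icc (0 : ℝ) 1 := ⟨zero_le_one, le_rfl⟩
  set D : ℝ → ℝ := fun t => ∑ i, ∫ u in (π.quantile t i)..1, (π.optForm i u - y i u) with hDdef
  have hcont : ContinuousOn D (Ici 0) := by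
    refine continuousOn_finsetSum _ fun i _ => ?_
    have h1 : ContinuousOn (fun a => ∫ u in a..1, (π.optForm i u - y i u)) (Icc 0 1) := by
      have h2 := intervalIntegral.continuousOn_primitive_interval_left
        (f := fun u => π.optForm i u - y i u) (μ := MeasureTheory.volume) (a := 0) (b := 1) (by
          rw [uIcc_of_le zero_le_one]
          exact (intervalIntegrable_iff_integrableOn_Icc_of_le zero_le_one).1
            (π.sub_intervalIntegrable hy.1 i hI hI1))
      rwa [uIcc_of_le zero_le_one] at h2
    exact h1.comp (π.quantile_continuousOn i) fun t ht => π.quantile_mem ht i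
  by_contra hne
  -- A nonzero value at `t` would persist on an interval of earlier times. The strictly decreasing
  -- continuous `p` carries it to an interval of positive prices, and the slack vanishes at some
  -- price in it.
  have hev := ((hcont t ht).mono (Ico_subset_Ici_self : Ico 0 t ⊆ Ici 0)).eventually_ne hne
  rw [nhdsWithin_Ico_eq_nhdsLT ht'] at hev
  obtain ⟨s, hs, hsub⟩ := (mem_nhdsLT_iff_exists_Ioo_subset' ht').1 hev
  set s' := max s 0 with hs'
  have hs't : s' < t := max_lt hs ht'
  have hs'0 : 0 ≤ s' := le_max_right _ _
  have hps := π.anti hs'0 ht hs't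
  obtain ⟨q, hq, hq0⟩ := exists_of_integral_eq_zero π.p_zero_pos.le
    (π.slack_intervalIntegrable hy.1) (fun _ h => π.slack_nonneg hy.1 h)
    (π.integrals_eq_zero hy).2 hp hps (π.p_anti le_rfl hs'0)
  obtain ⟨r, hr, rfl⟩ := intermediate_value_Icc' hs't.le
    ((π.p_continuousOn i₀).mono fun x hx => hs'0.trans hx.1) ⟨hq.1.le, hq.2.le⟩
  have hr0 : 0 ≤ r := hs'0.trans hr.1
  have hr1 : s < r := by
    refine lt_of_le_of_ne ((le_max_left s 0).trans hr.1) ?_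
    rintro rfl
    have : s' = s := le_antisymm hr.1 (le_max_left _ _)
    rw [this] at hq
    exact lt_irrefl _ hq.2
  have hr2 : r < t := by
    refine lt_of_le_of_ne hr.2 ?_
    rintro rfl
    exact lt_irrefl _ hq.1
  rw [π.slack_p hr0 (hp.trans_lt hq.1)] at hq0
  exact hsub ⟨hr1, hr2⟩ hq0

theorem optimal_quantile (hy : IsOptimal H y) {t : ℝ} (ht : 0 < t) (hp : 0 ≤ π.p t)
    (i : Fin n) : y i (π.quantile t i) = π.winProb t i := by
  have hcdf := hy.1.1 i
  have hI1 : (1 : ℝ) ∈ Icc (0 : ℝ) 1 := ⟨zero_le_one, le_rfl⟩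
  -- The constraint binds at the path point at time `s`, so moving coordinate `i` alone to `a`
  -- cannot raise the Border expression.
  have key : ∀ s, 0 ≤ s → 0 ≤ π.p s → ∀ a ∈ Icc (0 : ℝ) 1,
      (a - π.quantile s i) * π.winProb s i ≤ ∫ u in (π.quantile s i)..a, y i u := by
    intro s hs hps a ha
    have h1 := π.border_eq hy hs hps
    have h2 := hy.1.2 (Function.update (π.quantile s) i a) fun j => by
      rcases eq_or_ne j i with rfl | hj
      · simpa using ha
      · simpa [hj] using π.quantile_mem hs j
    rw [← Finset.mul_prod_erase _ _ (Finset.mem_univ i),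
      ← Finset.add_sum_erase _ _ (Finset.mem_univ i)] at h1 h2
    have h3 : ∏ j ∈ Finset.univ.erase i, Function.update (π.quantile s) i a j =
        π.winProb s i := by
      rw [π.winProb_eq_prod hs]
      exact Finset.prod_congr rfl fun j hj => by simp [Finset.ne_of_mem_erase hj]
    have h4 : ∑ j ∈ Finset.univ.erase i, (∫ u in (Function.update (π.quantile s) i a j)..1, y j u)
        = ∑ j ∈ Finset.univ.erase i, ∫ u in (π.quantile s j)..1, y j u :=
      Finset.sum_congr rfl fun j hj => by simp [Finset.ne_of_mem_erase hj]
    rw [h3, h4, Function.update_self] at h2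
    rw [← π.winProb_eq_prod hs, ← intervalIntegral.integral_add_adjacent_intervals
      (hcdf.intervalIntegrable (π.quantile_mem hs i) ha) (hcdf.intervalIntegrable ha hI1)] at h1
    linarith
  have hqmem := π.quantile_mem ht.le i
  refine le_antisymm ?_ ?_
  · have h1 : ∀ s, 0 ≤ s → s < t → y i (π.quantile t i) ≤ π.winProb s i := by
      intro s hs hst
      have hlt := (π.quantile_lt_iff ht.le hs i).2 hst
      have h2 := key s hs (hp.trans (π.p_anti hs hst.le)) _ hqmem
      rw [intervalIntegral.integral_symm] at h2
      have h3 : (π.quantile s i - π.quantile t i) * y i (π.quantile t i) ≤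
          ∫ u in (π.quantile t i)..(π.quantile s i), y i u := by
        calc _ = ∫ u in (π.quantile t i)..(π.quantile s i), y i (π.quantile t i) := by simp
          _ ≤ _ := intervalIntegral.integral_mono_on hlt.le (by simp)
            (hcdf.intervalIntegrable hqmem (π.quantile_mem hs i)) fun u hu =>
              hcdf.mono hqmem ⟨hqmem.1.trans hu.1, hu.2.trans (π.quantile_le_one hs i)⟩ hu.1
      refine le_of_mul_le_mul_left ?_ (sub_pos.2 hlt)
      linarith
    have hc : ContinuousWithinAt (fun t => π.winProb t i) (Ico 0 t) t :=
      ((π.winProb_continuousOn i) t ht.le).mono fun s hs => hs.1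
    have hne : (nhdsWithin t (Ico 0 t)).NeBot := by
      rw [nhdsWithin_Ico_eq_nhdsLT ht]; infer_instance
    refine ge_of_tendsto hc ?_
    filter_upwards [self_mem_nhdsWithin] with s hs
    exact h1 s hs.1 hs.2
  · have hlt1 : π.quantile t i < 1 := by
      rw [← π.quantile_zero i]; exact (π.quantile_lt_iff ht.le le_rfl i).2 ht
    -- The lower bound moves the coordinate up from time `t` itself and uses right-continuity.
    have h1 : ∀ a ∈ Ioc (π.quantile t i) 1, π.winProb t i ≤ y i a := by
      intro a ha
      have hamem : a ∈ Icc (0 : ℝ) 1 := ⟨hqmem.1.trans ha.1.le, ha.2⟩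
      have h2 := key t ht.le hp a hamem
      have h3 : ∫ u in (π.quantile t i)..a, y i u ≤ (a - π.quantile t i) * y i a := by
        calc _ ≤ ∫ u in (π.quantile t i)..a, y i a :=
              intervalIntegral.integral_mono_on ha.1.le
                (hcdf.intervalIntegrable hqmem hamem) (by simp) fun u hu =>
                hcdf.mono ⟨hqmem.1.trans hu.1, hu.2.trans ha.2⟩ hamem hu.2
          _ = _ := by simp
      exact le_of_mul_le_mul_left (h2.trans h3) (sub_pos.2 ha.1)
    have hc : ContinuousWithinAt (y i) (Ioc (π.quantile t i) 1) (π.quantile t i) :=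
      (hcdf.rightCont _ ⟨hqmem.1, hlt1⟩).mono fun a ha => ha.1.le
    have hne : (nhdsWithin (π.quantile t i) (Ioc (π.quantile t i) 1)).NeBot := by
      rw [nhdsWithin_Ioc_eq_nhdsGT hlt1]; infer_instance
    refine ge_of_tendsto hc ?_
    filter_upwards [self_mem_nhdsWithin] with a ha
    exact h1 a ha

end PricePath

/-! ### Quantile function and hazard rate. -/

namespace TypeDistribution

variable (D : TypeDistribution)

theorem f_intervalIntegrable {a b : ℝ} (ha : a ∈ Icc D.lo D.hi) (hb : b ∈ Icc D.lo D.hi) :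
    IntervalIntegrable D.f MeasureTheory.volume a b :=
  (D.f_cont.mono (uIcc_subset_Icc ha hb)).intervalIntegrable

theorem lo_mem : D.lo ∈ Icc D.lo D.hi := ⟨le_rfl, D.lo_lt_hi.le⟩

theorem hi_mem : D.hi ∈ Icc D.lo D.hi := ⟨D.lo_lt_hi.le, le_rfl⟩

theorem F_sub {a b : ℝ} (ha : a ∈ Icc D.lo D.hi) (hb : b ∈ Icc D.lo D.hi) :
    D.F b - D.F a = ∫ s in a..b, D.f s := by
  rw [F, F, intervalIntegral.integral_interval_sub_left (D.f_intervalIntegrable D.lo_mem hb)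
    (D.f_intervalIntegrable D.lo_mem ha)]

/-- The constant is the minimum of the density. It makes the quantile function strictly increasing
and Lipschitz. -/
theorem exists_mul_sub_le_F_sub : ∃ c > 0, ∀ a ∈ Icc D.lo D.hi, ∀ b ∈ Icc D.lo D.hi, a ≤ b →
    c * (b - a) ≤ D.F b - D.F a := by
  obtain ⟨z, hz, hmin⟩ := isCompact_Icc.exists_isMinOn ⟨D.lo, D.lo_mem⟩ D.f_cont
  refine ⟨D.f z, D.f_pos z hz, fun a ha b hb hab => ?_⟩
  rw [D.F_sub ha hb]
  calc D.f z * (b - a) = ∫ _ in a..b, D.f z := by simp [mul_comm]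
    _ ≤ _ := intervalIntegral.integral_mono_on hab (by simp) (D.f_intervalIntegrable ha hb)
      fun s hs => hmin (⟨ha.1.trans hs.1, hs.2.trans hb.2⟩ : s ∈ Icc D.lo D.hi)

theorem F_continuousOn : ContinuousOn D.F (Icc D.lo D.hi) := by
  have h := intervalIntegral.continuousOn_primitive_interval (f := D.f)
    (μ := MeasureTheory.volume) (a := D.lo) (b := D.hi) (by
      rw [uIcc_of_le D.lo_lt_hi.le]
      exact (intervalIntegrable_iff_integrableOn_Icc_of_le D.lo_lt_hi.le).1
        (D.f_intervalIntegrable D.lo_mem D.hi_mem))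
  rwa [uIcc_of_le D.lo_lt_hi.le] at h

theorem exists_F_eq {u : ℝ} (hu : u ∈ Icc (0 : ℝ) 1) : ∃ θ ∈ Icc D.lo D.hi, D.F θ = u := by
  have h0 : D.F D.lo = 0 := by simp [F]
  have h1 : D.F D.hi = 1 := D.f_total
  exact intermediate_value_Icc D.lo_lt_hi.le D.F_continuousOn (by rwa [h0, h1])

theorem v_mem {u : ℝ} (hu : u ∈ Icc (0 : ℝ) 1) : D.v u ∈ Icc D.lo D.hi :=
  Function.invFunOn_mem (D.exists_F_eq hu)

theorem F_v {u : ℝ} (hu : u ∈ Icc (0 : ℝ) 1) : D.F (D.v u) = u :=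
  Function.invFunOn_eq (D.exists_F_eq hu)

theorem v_strictMonoOn : StrictMonoOn D.v (Icc 0 1) := by
  obtain ⟨c, hc, h⟩ := D.exists_mul_sub_le_F_sub
  intro u hu w hw huw
  by_contra hcon
  push Not at hcon
  have h1 := h _ (D.v_mem hw) _ (D.v_mem hu) hcon
  rw [D.F_v hu, D.F_v hw] at h1
  nlinarith

theorem v_continuousOn : ContinuousOn D.v (Icc 0 1) := by
  obtain ⟨c, hc, h⟩ := D.exists_mul_sub_le_F_sub
  have key : ∀ u ∈ Icc (0 : ℝ) 1, ∀ w ∈ Icc (0 : ℝ) 1, u ≤ w →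
      D.v w - D.v u ≤ c⁻¹ * (w - u) := by
    intro u hu w hw huw
    have h1 := h _ (D.v_mem hu) _ (D.v_mem hw) (D.v_strictMonoOn.monotoneOn hu hw huw)
    rw [D.F_v hu, D.F_v hw] at h1
    rw [inv_mul_eq_div, le_div_iff₀ hc]
    linarith
  have : LipschitzOnWith (Real.toNNReal c⁻¹) D.v (Icc 0 1) := by
    refine LipschitzOnWith.of_dist_le_mul fun u hu w hw => ?_
    rw [Real.coe_toNNReal _ (inv_nonneg.2 hc.le), Real.dist_eq, Real.dist_eq]
    rcases le_total u w with huw | huw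
    · rw [abs_sub_comm, abs_sub_comm u, abs_of_nonneg (sub_nonneg.2 huw), abs_of_nonneg
        (sub_nonneg.2 (D.v_strictMonoOn.monotoneOn hu hw huw))]
      exact key u hu w hw huw
    · rw [abs_of_nonneg (sub_nonneg.2 huw), abs_of_nonneg
        (sub_nonneg.2 (D.v_strictMonoOn.monotoneOn hw hu huw))]
      exact key w hw u hu huw
  exact this.continuousOn

theorem v_one_pos : 0 < D.v 1 := by
  have h0 : (0 : ℝ) ∈ Icc (0 : ℝ) 1 := ⟨le_rfl, zero_le_one⟩
  exact (D.lo_nonneg.trans (D.v_mem h0).1).trans_lt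
    (D.v_strictMonoOn h0 ⟨zero_le_one, le_rfl⟩ zero_lt_one)

/-- The inverse hazard rate in quantile space. -/
noncomputable def hazardInv (u : ℝ) : ℝ := (1 - D.F (D.v u)) / D.f (D.v u)

theorem hazardInv_nonneg {u : ℝ} (hu : u ∈ Icc (0 : ℝ) 1) : 0 ≤ D.hazardInv u := by
  rw [hazardInv, D.F_v hu]
  exact div_nonneg (by linarith [hu.2]) (D.f_pos _ (D.v_mem hu)).le

theorem hazardInv_pos {u : ℝ} (hu : u ∈ Ico (0 : ℝ) 1) : 0 < D.hazardInv u := by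
  have hu' : u ∈ Icc (0 : ℝ) 1 := ⟨hu.1, hu.2.le⟩
  rw [hazardInv, D.F_v hu']
  exact div_pos (by linarith [hu.2]) (D.f_pos _ (D.v_mem hu'))

theorem hazardInv_one : D.hazardInv 1 = 0 := by
  rw [hazardInv, D.F_v ⟨zero_le_one, le_rfl⟩]; simp

theorem hazardInv_continuousOn : ContinuousOn D.hazardInv (Icc 0 1) := by
  refine ContinuousOn.div (continuousOn_const.sub ?_) ?_ fun u hu => (D.f_pos _ (D.v_mem hu)).ne'
  · exact D.F_continuousOn.comp D.v_continuousOn fun u hu => D.v_mem hu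
  · exact D.f_cont.comp D.v_continuousOn fun u hu => D.v_mem hu

end TypeDistribution

/-! ### Convex certainty equivalents and marginal revenue. -/

/-- A continuously differentiable convex function on the unit interval. -/
structure IsSmoothConvex (c : ℝ → ℝ) : Prop where
  diff : DifferentiableOn ℝ c (Icc 0 1)
  cont_deriv : ContinuousOn (derivWithin c (Icc 0 1)) (Icc 0 1)
  mono_deriv : MonotoneOn (derivWithin c (Icc 0 1)) (Icc 0 1)

theorem derivWithin_id_Icc {x : ℝ} (hx : x ∈ Icc (0 : ℝ) 1) :
    derivWithin (fun x : ℝ => x) (Icc 0 1) x = 1 :=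
  derivWithin_id' x _ (uniqueDiffOn_Icc zero_lt_one x hx)

theorem isSmoothConvex_id : IsSmoothConvex fun x => x where
  diff := differentiableOn_id
  cont_deriv := continuousOn_const.congr fun x hx => derivWithin_id_Icc hx
  mono_deriv := fun x hx y hy _ => by rw [derivWithin_id_Icc hx, derivWithin_id_Icc hy]

theorem IsRiskAverse.strictMonoOn_derivWithin {g : ℝ → ℝ} (hg : IsRiskAverse g) :
    StrictMonoOn (derivWithin g (Icc 0 1)) (Icc 0 1) := by
  refine strictMonoOn_of_deriv_pos (convex_Icc 0 1)
    (hg.contDiff.continuousOn_derivWithin (uniqueDiffOn_Icc zero_lt_one) (by norm_num)) ?_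
  intro x hx
  rw [interior_Icc] at hx
  have heq : derivWithin g (Icc 0 1) =ᶠ[nhds x] deriv g := by
    filter_upwards [Ioo_mem_nhds hx.1 hx.2] with z hz
    exact derivWithin_of_mem_nhds (Icc_mem_nhds hz.1 hz.2)
  rw [heq.deriv_eq]
  exact hg.deriv2_pos x hx

theorem IsRiskAverse.isSmoothConvex {g : ℝ → ℝ} (hg : IsRiskAverse g) : IsSmoothConvex g where
  diff := hg.contDiff.differentiableOn (by norm_num)
  cont_deriv := hg.contDiff.continuousOn_derivWithin (uniqueDiffOn_Icc zero_lt_one) (by norm_num)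
  mono_deriv := hg.strictMonoOn_derivWithin.monotoneOn

namespace IsSmoothConvex

variable {c : ℝ → ℝ} (hc : IsSmoothConvex c)

include hc

theorem exists_slope {x y : ℝ} (hx : 0 ≤ x) (hxy : x < y) (hy : y ≤ 1) :
    ∃ z ∈ Ioo x y, derivWithin c (Icc 0 1) z * (y - x) = c y - c x := by
  obtain ⟨z, hz, h⟩ := exists_hasDerivAt_eq_slope c (derivWithin c (Icc 0 1)) hxy
    (hc.diff.continuousOn.mono (Icc_subset_Icc hx hy)) fun z hz =>
      (hc.diff z ⟨hx.trans hz.1.le, hz.2.le.trans hy⟩).hasDerivWithinAt.hasDerivAt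
        (Icc_mem_nhds (hx.trans_lt hz.1) (hz.2.trans_le hy))
  refine ⟨z, hz, ?_⟩
  rw [h, div_mul_cancel₀ _ (sub_pos.2 hxy).ne']

theorem tangent {x y : ℝ} (hx : x ∈ Icc (0 : ℝ) 1) (hy : y ∈ Icc (0 : ℝ) 1) :
    derivWithin c (Icc 0 1) x * (y - x) ≤ c y - c x := by
  rcases lt_trichotomy x y with hxy | rfl | hxy
  · obtain ⟨z, hz, h⟩ := hc.exists_slope hx.1 hxy hy.2
    have := hc.mono_deriv hx ⟨hx.1.trans hz.1.le, hz.2.le.trans hy.2⟩ hz.1.le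
    nlinarith
  · simp
  · obtain ⟨z, hz, h⟩ := hc.exists_slope hy.1 hxy hx.2
    have := hc.mono_deriv ⟨hy.1.trans hz.1.le, hz.2.le.trans hx.2⟩ hx hz.2.le
    nlinarith

theorem hasDerivWithinAt_J (D : TypeDistribution) {x : ℝ} (hx : x ∈ Icc (0 : ℝ) 1) (u : ℝ) :
    HasDerivWithinAt (fun y => D.J c y (D.v u))
      (D.v u - D.hazardInv u * derivWithin c (Icc 0 1) x) (Icc 0 1) x := by
  have h1 := ((hasDerivWithinAt_id x (Icc (0 : ℝ) 1)).const_mul (D.v u)).sub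
    ((hc.diff x hx).hasDerivWithinAt.const_mul (D.hazardInv u))
  rw [mul_one] at h1
  exact h1

theorem partialX_eq (D : TypeDistribution) {x : ℝ} (hx : x ∈ Icc (0 : ℝ) 1) (u : ℝ) :
    partialX (fun x u => D.J c x (D.v u)) x u =
      D.v u - D.hazardInv u * derivWithin c (Icc 0 1) x :=
  (hc.hasDerivWithinAt_J D hx u).derivWithin (uniqueDiffOn_Icc zero_lt_one x hx)

theorem isMarginal (D : TypeDistribution)
    (hs : IsSupermodular fun x u => D.J c x (D.v u)) :
    IsMarginal (fun x u => D.J c x (D.v u)) (partialX fun x u => D.J c x (D.v u)) where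
  continuousOn := by
    have hv : ContinuousOn (fun q : ℝ × ℝ => D.v q.2) (Icc 0 1 ×ˢ Icc 0 1) :=
      D.v_continuousOn.comp continuousOn_snd fun q hq => hq.2
    have hh : ContinuousOn (fun q : ℝ × ℝ => D.hazardInv q.2) (Icc 0 1 ×ˢ Icc 0 1) :=
      D.hazardInv_continuousOn.comp continuousOn_snd fun q hq => hq.2
    have hcc : ContinuousOn (fun q : ℝ × ℝ => c q.1) (Icc 0 1 ×ˢ Icc 0 1) :=
      hc.diff.continuousOn.comp continuousOn_fst fun q hq => hq.1
    exact (hv.mul continuousOn_fst).sub (hh.mul hcc)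
  continuousOn_marginal := by
    have hv : ContinuousOn (fun q : ℝ × ℝ => D.v q.2) (Icc 0 1 ×ˢ Icc 0 1) :=
      D.v_continuousOn.comp continuousOn_snd fun q hq => hq.2
    have hh : ContinuousOn (fun q : ℝ × ℝ => D.hazardInv q.2) (Icc 0 1 ×ˢ Icc 0 1) :=
      D.hazardInv_continuousOn.comp continuousOn_snd fun q hq => hq.2
    have hcc : ContinuousOn (fun q : ℝ × ℝ => derivWithin c (Icc 0 1) q.1)
        (Icc 0 1 ×ˢ Icc 0 1) :=
      hc.cont_deriv.comp continuousOn_fst fun q hq => hq.1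
    exact (hv.sub (hh.mul hcc)).congr fun q hq => hc.partialX_eq D hq.1 q.2
  anti u hu x hx y hy hxy := by
    simp only [hc.partialX_eq D hx, hc.partialX_eq D hy]
    have := mul_le_mul_of_nonneg_left (hc.mono_deriv hx hy hxy) (D.hazardInv_nonneg hu)
    linarith
  mono x hx u hu w hw huw := by
    -- Supermodularity means increasing differences, so the difference of the objectives at two
    -- quantiles has a nonnegative derivative in `x`.
    have hmono : MonotoneOn (fun y => D.J c y (D.v w) - D.J c y (D.v u)) (Icc 0 1) := by
      intro a ha b hb hab
      have := hs a ha b hb w hw u hu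
      simp only [max_eq_right hab, min_eq_left hab, max_eq_left huw, min_eq_right huw] at this
      simp only
      linarith
    have h1 := hmono.derivWithin_nonneg (x := x)
    have h2 := HasDerivWithinAt.derivWithin
      ((hc.hasDerivWithinAt_J D hx w).sub (hc.hasDerivWithinAt_J D hx u))
      (uniqueDiffOn_Icc zero_lt_one x hx)
    replace h1 := h1.trans_eq h2
    rw [hc.partialX_eq D hx, hc.partialX_eq D hx]
    linarith
  tangent u hu x hx y hy := by
    rw [hc.partialX_eq D hx]
    have := mul_le_mul_of_nonneg_left (hc.tangent hx hy) (D.hazardInv_nonneg hu)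
    change D.v u * y - D.hazardInv u * c y - (D.v u * x - D.hazardInv u * c x) ≤ _
    nlinarith

end IsSmoothConvex

theorem IsRiskAverse.derivWithin_eq_one {g : ℝ → ℝ} (hg : IsRiskAverse g) {m : ℝ}
    (hm : m ∈ Ioo (0 : ℝ) 1) (hpeak : IsUnimodalAt (fun x => x - g x) m) :
    derivWithin g (Icc 0 1) m = 1 := by
  have hmI : m ∈ Icc (0 : ℝ) 1 := ⟨hm.1.le, hm.2.le⟩
  have hmax : IsLocalMax (fun x => x - g x) m := by
    filter_upwards [Ioo_mem_nhds hm.1 hm.2] with x hx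
    rcases le_total x m with h | h
    · exact hpeak.1 ⟨hx.1.le, h⟩ ⟨hm.1.le, le_rfl⟩ h
    · exact hpeak.2 ⟨le_rfl, hm.2.le⟩ ⟨h, hx.2.le⟩ h
  have hd := (hg.isSmoothConvex.diff m hmI).hasDerivWithinAt.hasDerivAt (Icc_mem_nhds hm.1 hm.2)
  have := hmax.hasDerivAt_eq_zero ((hasDerivAt_id m).sub hd)
  linarith

theorem revenueFn_of_lt (D : TypeDistribution) {n k : ℕ} (g : ℝ → ℝ) {i : Fin n} (hi : i.val < k) :
    revenueFn D k g i = fun x u => D.J (fun x => x) x (D.v u) := by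
  funext x u; simp [revenueFn, certEquiv, hi]

theorem revenueFn_of_le (D : TypeDistribution) {n k : ℕ} (g : ℝ → ℝ) {j : Fin n} (hj : k ≤ j.val) :
    revenueFn D k g j = fun x u => D.J g x (D.v u) := by
  funext x u; simp [revenueFn, certEquiv, not_lt.2 hj]

theorem revenueFn_isMarginal (D : TypeDistribution) {n k : ℕ} {g : ℝ → ℝ} (hg : IsRiskAverse g)
    (i : Fin n) (hs : IsSupermodular (revenueFn D k g i)) :
    IsMarginal (revenueFn D k g i) (partialX (revenueFn D k g i)) := by
  rcases lt_or_ge i.val k with hi | hi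
  · rw [revenueFn_of_lt D g hi] at hs ⊢
    exact isSmoothConvex_id.isMarginal D hs
  · rw [revenueFn_of_le D g hi] at hs ⊢
    exact hg.isSmoothConvex.isMarginal D hs

theorem partialX_revenueFn_of_lt (D : TypeDistribution) {n k : ℕ} (g : ℝ → ℝ) {i : Fin n}
    (hi : i.val < k) {x : ℝ} (hx : x ∈ Icc (0 : ℝ) 1) (u : ℝ) :
    partialX (revenueFn D k g i) x u = D.v u - D.hazardInv u := by
  rw [revenueFn_of_lt D g hi, isSmoothConvex_id.partialX_eq D hx, derivWithin_id_Icc hx, mul_one]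

theorem partialX_revenueFn_of_le (D : TypeDistribution) {n k : ℕ} {g : ℝ → ℝ}
    (hg : IsRiskAverse g) {j : Fin n} (hj : k ≤ j.val) {x : ℝ} (hx : x ∈ Icc (0 : ℝ) 1) (u : ℝ) :
    partialX (revenueFn D k g j) x u = D.v u - D.hazardInv u * derivWithin g (Icc 0 1) x := by
  rw [revenueFn_of_le D g hj, hg.isSmoothConvex.partialX_eq D hx]

/-! ### The path given by regularity. -/

theorem SolvesSystem.comp_perm {n : ℕ} {H : Fin n → ℝ → ℝ → ℝ} {t p : ℝ} {δ : Fin n → ℝ}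
    (h : SolvesSystem H t δ p) (σ : Equiv.Perm (Fin n)) (hσ : ∀ i, H (σ i) = H i) :
    SolvesSystem H t (δ ∘ σ) p :=
  ⟨fun i => h.1 (σ i), fun i => by rw [← hσ i]; exact h.2.1 (σ i), by
    rw [← h.2.2]; exact Equiv.sum_comp σ δ⟩

/-- The unique solutions of the system form a path with a common price. -/
theorem exists_pricePath {n k : ℕ} (hn : 0 < n) (D : TypeDistribution) {g : ℝ → ℝ}
    (hg : IsRiskAverse g) (hreg : IsRegular (fun i : Fin n => revenueFn D k g i))
    (hsuper : ∀ i : Fin n, IsSupermodular (revenueFn D k g i)) :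
    ∃ π : PricePath (fun i : Fin n => revenueFn D k g i)
      (fun i => partialX (revenueFn D k g i)),
      ∀ t : ℝ, 0 ≤ t → ∀ (δ : Fin n → ℝ) (p : ℝ),
        SolvesSystem (fun i : Fin n => revenueFn D k g i) t δ p → δ = π.δ t ∧ p = π.p t := by
  obtain ⟨-, δs, ps, hsol, hmono, hanti⟩ := hreg
  have hS : ∀ t, 0 ≤ t → SolvesSystem (fun i : Fin n => revenueFn D k g i) t (δs t) (ps t) :=
    fun t ht => (hsol t ht _ _).2 ⟨rfl, rfl⟩
  let β : BorderPath n := ⟨δs, fun t ht => (hS t ht).1, fun t ht => (hS t ht).2.2, hmono⟩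
  have hfoc : ∀ t, 0 ≤ t → ∀ i,
      partialX (revenueFn D k g i) (β.winProb t i) (β.quantile t i) = ps t :=
    fun t ht => (hS t ht).2.1
  -- At time 0 all quantiles are 1, where the inverse hazard rate vanishes and marginal revenue is
  -- the top type.
  have hp0 : 0 < ps 0 := by
    have h1 : (1 : ℝ) ∈ Icc (0 : ℝ) 1 := ⟨zero_le_one, le_rfl⟩
    have h2 := hfoc 0 le_rfl ⟨0, hn⟩
    rw [β.winProb_zero, β.quantile_zero] at h2
    rw [← h2]
    rcases lt_or_ge (⟨0, hn⟩ : Fin n).val k with hi | hi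
    · rw [partialX_revenueFn_of_lt D g hi h1, D.hazardInv_one, sub_zero]
      exact D.v_one_pos
    · rw [partialX_revenueFn_of_le D hg hi h1, D.hazardInv_one, zero_mul, sub_zero]
      exact D.v_one_pos
  exact ⟨{ toBorderPath := β
           p := ps
           marginal := fun i => revenueFn_isMarginal D hg i (hsuper i)
           anti := hanti
           foc := hfoc
           p_zero_pos := hp0 }, fun t ht δ p h => (hsol t ht δ p).1 h⟩

/-! ### Comparing risk-neutral and risk-averse bidders. -/

section Comparison

variable {n k : ℕ} {D : TypeDistribution} {g : ℝ → ℝ}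
  (π : PricePath (fun i : Fin n => revenueFn D k g i) (fun i => partialX (revenueFn D k g i)))

include π

theorem PricePath.marginalRevenue_lt {i : Fin n} (hi : i.val < k) {t u : ℝ} (ht : 0 ≤ t)
    (hu : 0 ≤ u) (hlt : u < π.quantile t i) : D.v u - D.hazardInv u < π.p t := by
  obtain ⟨s, hts, hs⟩ := π.exists_gt_le_quantile ht hlt
  have hs0 := ht.trans hts.le
  have h1 := (π.marginal i).mono _ (π.winProb_mem hs0 i)
    ⟨hu, hlt.le.trans (π.quantile_le_one ht i)⟩ (π.quantile_mem hs0 i) hs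
  have h2 := π.foc s hs0 i
  rw [h2, partialX_revenueFn_of_lt D g hi (π.winProb_mem hs0 i)] at h1
  exact h1.trans_lt (π.anti ht hs0 hts)

theorem PricePath.lt_marginalRevenue {i : Fin n} (hi : i.val < k) {t u : ℝ} (ht : 0 ≤ t)
    (hu : u ≤ 1) (hlt : π.quantile t i < u) : π.p t < D.v u - D.hazardInv u := by
  obtain ⟨s, hs0, _, rfl⟩ := π.exists_quantile_eq hu i ht hlt.le
  have h2 := π.foc s hs0 i
  rw [partialX_revenueFn_of_lt D g hi (π.winProb_mem hs0 i)] at h2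
  rw [h2]
  exact π.anti hs0 ht ((π.quantile_lt_iff ht hs0 i).1 hlt)

/-- Swapping two identical bidders gives another solution of the system, so uniqueness makes their
coordinates equal. -/
theorem PricePath.δ_eq_of_revenueFn_eq
    (huniq : ∀ t : ℝ, 0 ≤ t → ∀ (δ : Fin n → ℝ) (p : ℝ),
      SolvesSystem (fun i : Fin n => revenueFn D k g i) t δ p → δ = π.δ t ∧ p = π.p t)
    {a b : Fin n} (hab : revenueFn D k g a = revenueFn D k g b) {t : ℝ} (ht : 0 ≤ t) :
    π.δ t a = π.δ t b := by
  have hS : SolvesSystem (fun i : Fin n => revenueFn D k g i) t (π.δ t) (π.p t) :=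
    ⟨π.nonneg t ht, π.foc t ht, π.sum_eq t ht⟩
  have h1 := (huniq t ht _ _ (hS.comp_perm (Equiv.swap a b) fun i => by
    rcases eq_or_ne i a with rfl | hia
    · rw [Equiv.swap_apply_left]; exact hab.symm
    · rcases eq_or_ne i b with rfl | hib
      · rw [Equiv.swap_apply_right]; exact hab
      · rw [Equiv.swap_apply_of_ne_of_ne hia hib])).1
  have h2 := congrFun h1 a
  simp only [Function.comp, Equiv.swap_apply_left] at h2
  exact h2.symm

/-- In an optimal reduced form, a risk-neutral bidder never wins at quantiles below those that the
path reaches with a nonnegative price. -/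
theorem PricePath.optimal_eq_zero {y : Fin n → ℝ → ℝ}
    (hy : IsOptimal (fun i : Fin n => revenueFn D k g i) y) {i : Fin n} (hi : i.val < k)
    {u s : ℝ} (hu : 0 < u) (hs : 0 ≤ s) (hp : π.p s ≤ 0) (hlt : u < π.quantile s i) :
    y i u = 0 := by
  -- The loss vanishes only almost everywhere, so a suitable `w > u` is chosen. At price 0 the
  -- linear objective has negative slope there, which forces `y i w = 0`, and monotonicity gives `y
  -- i u = 0`.
  obtain ⟨w, hw, hloss⟩ := π.exists_loss_eq_zero hy i hu.le hlt (π.quantile_le_one hs i)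
  have hw1 : w ≤ 1 := hw.2.le.trans (π.quantile_le_one hs i)
  have hwI : w ∈ Icc (0 : ℝ) 1 := ⟨hu.le.trans hw.1.le, hw1⟩
  have huI : u ∈ Icc (0 : ℝ) 1 := ⟨hu.le, hw.1.le.trans hw1⟩
  have hprice : π.price i w = 0 := by
    refine le_antisymm ?_ (π.price_nonneg i w)
    simpa [max_eq_right hp] using π.price_le hs hw.2.le
  have hmax := π.optForm_maximizes (i := i) (y := 0) ⟨hu.trans hw.1, hw1⟩ ⟨le_rfl, zero_le_one⟩
  rw [PricePath.loss, hprice] at hloss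
  rw [hprice] at hmax
  simp only [zero_mul, sub_zero] at hloss hmax
  have hMR := (π.marginalRevenue_lt hi hs hwI.1 hw.2).trans_le hp
  have hval : ∀ x, revenueFn D k g i x w = (D.v w - D.hazardInv w) * x := by
    intro x
    rw [revenueFn_of_lt D g hi]
    simp only [TypeDistribution.J, TypeDistribution.hazardInv]
    ring
  simp only [hval] at hloss hmax
  have hyw := (hy.1.1 i).mem w hwI
  have hyw0 : y i w ≤ 0 := by
    by_contra hcon
    push Not at hcon
    have := mul_neg_of_neg_of_pos hMR hcon
    linarith
  exact le_antisymm (((hy.1.1 i).mono huI hwI hw.1.le).trans hyw0) ((hy.1.1 i).mem u huI).1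

end Comparison

end CRA

theorem proposition5 (n k : ℕ) (hk : 0 < k) (hkn : k < n)
    (D : CRA.TypeDistribution) (g : ℝ → ℝ) (hg : CRA.IsRiskAverse g)
    (m : ℝ) (hm : m ∈ Set.Ioo (0 : ℝ) 1) (hpeak : CRA.IsUnimodalAt (fun x => x - g x) m)
    (hJ : ∀ i : Fin n, ContDiffOn ℝ 2 (fun q : ℝ × ℝ => D.J (CRA.certEquiv k g i) q.1 q.2)
      (Set.Icc 0 1 ×ˢ Set.Icc D.lo D.hi))
    (hreg : CRA.IsRegular (fun i : Fin n => CRA.revenueFn D k g i))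
    (hsuper : ∀ i : Fin n, CRA.IsSupermodular (CRA.revenueFn D k g i))
    (hpos : ∀ i : Fin n,
      0 < CRA.partialX (CRA.revenueFn D k g i) m (m ^ (1 / ((n : ℝ) - 1)))) :
    (∃ x, CRA.IsOptimal (fun i : Fin n => CRA.revenueFn D k g i) x) ∧
    ∀ x, CRA.IsOptimal (fun i : Fin n => CRA.revenueFn D k g i) x →
      ∀ i j : Fin n, i.val < k → k ≤ j.val → ∀ u ∈ Set.Ioo (0 : ℝ) 1,
        (x j u < x i u ↔ m ^ (1 / ((n : ℝ) - 1)) < u) ∧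
        (x i u = x j u ∧ 0 < x j u ↔ u = m ^ (1 / ((n : ℝ) - 1))) ∧
        (x i u < x j u ↔ u < m ^ (1 / ((n : ℝ) - 1)) ∧ 0 < x j u) := by
  obtain ⟨π, huniq⟩ := CRA.exists_pricePath (by omega) D hg hreg hsuper
  refine ⟨⟨_, π.optForm_isOptimal⟩, ?_⟩
  intro y hy i j hi hj u hu
  have hmI : m ∈ Icc (0 : ℝ) 1 := ⟨hm.1.le, hm.2.le⟩
  have hn1 : (0 : ℝ) < (n : ℝ) - 1 := by
    have : (2 : ℝ) ≤ n := by exact_mod_cast (by omega : 2 ≤ n)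
    linarith
  -- `L` is the log-quantile of the crossing point. With `T = n * L`, the winning probability at the
  -- symmetric point is `e^{L - T} = m`.
  obtain ⟨L, hL⟩ : ∃ L, L = -(Real.log m / ((n : ℝ) - 1)) := ⟨_, rfl⟩
  have hLpos : 0 < L := by
    rw [hL, neg_pos]
    exact div_neg_of_neg_of_pos (Real.log_neg hm.1 hm.2) hn1
  have hL1 : ((n : ℝ) - 1) * L = -Real.log m := by rw [hL]; field_simp
  have hustar : m ^ (1 / ((n : ℝ) - 1)) = Real.exp (-L) := by
    rw [Real.rpow_def_of_pos hm.1, hL]; congr 1; ring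
  have hmexp : m = Real.exp (-(((n : ℝ) - 1) * L)) := by rw [hL1, neg_neg, Real.exp_log hm.1]
  rw [hustar] at hpos ⊢
  set T : ℝ := n * L with hT
  have hTpos : 0 < T := by
    have : (0 : ℝ) < n := by linarith
    positivity
  have hderiv := hg.derivWithin_eq_one hm hpeak
  have hTL : Real.exp (L - T) = m := by rw [hmexp, hT]; congr 1; ring
  have hsym : (fun _ => L) = π.δ T ∧ D.v (Real.exp (-L)) - D.hazardInv (Real.exp (-L)) = π.p T := by
    refine huniq T hTpos.le _ _ ⟨fun _ => hLpos.le, fun l => ?_, by simp [hT]⟩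
    change CRA.partialX (CRA.revenueFn D k g l) (Real.exp (L - T)) (Real.exp (-L)) = _
    rw [hTL]
    rcases lt_or_ge l.val k with hl | hl
    · rw [CRA.partialX_revenueFn_of_lt D g hl hmI]
    · rw [CRA.partialX_revenueFn_of_le D hg hl hmI, hderiv, mul_one]
  have hδT : ∀ l, π.δ T l = L := fun l => (congrFun hsym.1 l).symm
  have hqT : ∀ l, π.quantile T l = Real.exp (-L) := fun l => by
    rw [CRA.BorderPath.quantile, hδT]
  have hpT : 0 < π.p T := by
    rw [← hsym.2, ← CRA.partialX_revenueFn_of_lt D g hi hmI]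
    exact hpos i
  have hgrp : ∀ t, 0 ≤ t → ∀ l, π.δ t l = π.δ t i ∨ π.δ t l = π.δ t j := by
    intro t ht l
    rcases lt_or_ge l.val k with hl | hl
    · exact Or.inl (π.δ_eq_of_revenueFn_eq huniq
        (by rw [CRA.revenueFn_of_lt D g hl, CRA.revenueFn_of_lt D g hi]) ht)
    · exact Or.inr (π.δ_eq_of_revenueFn_eq huniq
        (by rw [CRA.revenueFn_of_le D g hl, CRA.revenueFn_of_le D g hj]) ht)
  have hfoc : ∀ t, 0 ≤ t → D.v (π.quantile t j) - D.hazardInv (π.quantile t j) *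
      derivWithin g (Icc 0 1) (π.winProb t j) = π.p t := by
    intro t ht
    rw [← CRA.partialX_revenueFn_of_le D hg hj (π.winProb_mem ht j)]
    exact π.foc t ht j
  have hwin_lt : ∀ t, π.winProb t j < m ↔ ((n : ℝ) - 1) * L < t - π.δ t j := by
    intro t
    rw [hmexp, CRA.BorderPath.winProb, Real.exp_lt_exp]
    constructor <;> intro h <;> linarith
  have hlt_win : ∀ t, m < π.winProb t j ↔ t - π.δ t j < ((n : ℝ) - 1) * L := by
    intro t
    rw [hmexp, CRA.BorderPath.winProb, Real.exp_lt_exp]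
    constructor <;> intro h <;> linarith
  have hgt : ∀ t, 0 ≤ t → π.δ t j < π.δ t i → t < T := by
    intro t ht hlt
    have hq : π.quantile t i < π.quantile t j := by
      rw [CRA.BorderPath.quantile, CRA.BorderPath.quantile, Real.exp_lt_exp]; linarith
    have h1 := π.lt_marginalRevenue hi ht (π.quantile_le_one ht j) hq
    have h2 := D.hazardInv_nonneg (π.quantile_mem ht j)
    -- The path price is below the risk-neutral marginal revenue at bidder `j`'s quantile, so `g' >
    -- 1` there and the winning probability exceeds `m`.
    have h3 : derivWithin g (Icc 0 1) m < derivWithin g (Icc 0 1) (π.winProb t j) := by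
      rw [hderiv]
      have := hfoc t ht
      by_contra hcon
      push Not at hcon
      nlinarith
    rw [hg.strictMonoOn_derivWithin.lt_iff_lt hmI (π.winProb_mem ht j), hlt_win] at h3
    -- Every coordinate equals one of two values, the smaller being `π.δ t j`. So `n * π.δ t j < t`,
    -- which with `h3` gives `π.δ t j < L`.
    have h4 : ∑ _l : Fin n, π.δ t j < ∑ l, π.δ t l :=
      Finset.sum_lt_sum (fun l _ => by rcases hgrp t ht l with h | h <;> rw [h]; exact hlt.le)
        ⟨i, Finset.mem_univ i, hlt⟩
    rw [π.sum_eq t ht] at h4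
    simp only [Finset.sum_const, Finset.card_univ, Fintype.card_fin, nsmul_eq_mul] at h4
    have h5 : π.δ t j < L := by
      refine lt_of_mul_lt_mul_left (?_ : ((n : ℝ) - 1) * π.δ t j < _) hn1.le
      linarith
    rwa [← hδT j, π.lt_iff ht hTpos.le] at h5
  have hless : ∀ t, 0 ≤ t → π.δ t i < π.δ t j → T < t := by
    intro t ht hlt
    have hq : π.quantile t j < π.quantile t i := by
      rw [CRA.BorderPath.quantile, CRA.BorderPath.quantile, Real.exp_lt_exp]; linarith
    have h1 := π.marginalRevenue_lt hi ht (π.quantile_pos t j).le hq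
    have h2 := D.hazardInv_nonneg (π.quantile_mem ht j)
    have h3 : derivWithin g (Icc 0 1) (π.winProb t j) < derivWithin g (Icc 0 1) m := by
      rw [hderiv]
      have := hfoc t ht
      by_contra hcon
      push Not at hcon
      nlinarith
    rw [hg.strictMonoOn_derivWithin.lt_iff_lt (π.winProb_mem ht j) hmI, hwin_lt] at h3
    have h4 : ∑ l, π.δ t l < ∑ _l : Fin n, π.δ t j :=
      Finset.sum_lt_sum (fun l _ => by rcases hgrp t ht l with h | h <;> rw [h]; exact hlt.le)
        ⟨i, Finset.mem_univ i, hlt⟩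
    rw [π.sum_eq t ht] at h4
    simp only [Finset.sum_const, Finset.card_univ, Fintype.card_fin, nsmul_eq_mul] at h4
    have h5 : L < π.δ t j := by
      refine lt_of_mul_lt_mul_left (?_ : _ < ((n : ℝ) - 1) * π.δ t j) hn1.le
      linarith
    rwa [← hδT j, π.lt_iff hTpos.le ht] at h5
  have heq : ∀ t, 0 < t → π.δ t i = π.δ t j → t = T := by
    intro t ht he
    have hδ : ∀ l, π.δ t l = π.δ t j := fun l => by
      rcases hgrp t ht.le l with h | h
      · rw [h, he]
      · exact h
    have hq : π.quantile t j = π.quantile t i := by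
      rw [CRA.BorderPath.quantile, CRA.BorderPath.quantile, he]
    have h0 := π.foc t ht.le i
    rw [CRA.partialX_revenueFn_of_lt D g hi (π.winProb_mem ht.le i), ← hq, ← hfoc t ht.le] at h0
    have hq1 : π.quantile t j < 1 := by
      rw [← π.quantile_zero j]; exact (π.quantile_lt_iff ht.le le_rfl j).2 ht
    have h2 := D.hazardInv_pos ⟨(π.quantile_pos t j).le, hq1⟩
    have h3 : derivWithin g (Icc 0 1) (π.winProb t j) = derivWithin g (Icc 0 1) m := by
      rw [hderiv]
      refine mul_left_cancel₀ h2.ne' ?_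
      linarith
    have h4 := hg.strictMonoOn_derivWithin.injOn (π.winProb_mem ht.le j) hmI h3
    have h5 := π.sum_eq t ht.le
    simp only [hδ, Finset.sum_const, Finset.card_univ, Fintype.card_fin, nsmul_eq_mul] at h5
    rw [hmexp, CRA.BorderPath.winProb, Real.exp_eq_exp] at h4
    have h6 : π.δ t j = L := mul_left_cancel₀ hn1.ne' (by linarith)
    rw [← h5, h6]
  have huI : u ∈ Icc (0 : ℝ) 1 := ⟨hu.1.le, hu.2.le⟩
  have hyj := (hy.1.1 j).mem u huI
  -- Either the path brings bidder `i` to `u` at a nonnegative price, and both bidders' values can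
  -- be read off the path, or bidder `i` gets zero at `u`.
  by_cases hA : ∃ t, 0 < t ∧ 0 ≤ π.p t ∧ π.quantile t i = u
  · obtain ⟨t, ht, hpt, hqt⟩ := hA
    have hyi : y i u = π.winProb t i := by rw [← hqt]; exact π.optimal_quantile hy ht hpt i
    have hTt : Real.exp (-L) < u ↔ t < T := by
      rw [← hqt, ← hqT i, π.quantile_lt_iff hTpos.le ht.le]
    have htT : u < Real.exp (-L) ↔ T < t := by
      rw [← hqt, ← hqT i, π.quantile_lt_iff ht.le hTpos.le]
    have hpath : ∀ s, 0 < s → 0 ≤ π.p s → π.δ s j = π.δ t i → y j u = Real.exp (π.δ t i - s) := by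
      intro s hs hps hse
      have : π.quantile s j = u := by
        rw [← hqt, CRA.BorderPath.quantile, CRA.BorderPath.quantile, hse]
      rw [← this, π.optimal_quantile hy hs hps j, CRA.BorderPath.winProb, hse]
    have hcont : ∀ a b, 0 ≤ a → ContinuousOn (fun t => π.δ t j) (Icc a b) := fun a b ha =>
      (π.continuousOn j).mono fun x hx => ha.trans hx.1
    rcases lt_trichotomy t T with h | h | h
    · have h1 : π.δ t j < π.δ t i := by
        rcases lt_trichotomy (π.δ t j) (π.δ t i) with h1 | h1 | h1
        · exact h1
        · exact absurd (heq t ht h1.symm) h.ne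
        · exact absurd (hless t ht.le h1) h.not_gt
      -- Bidder `j` is behind at time `t` but level at `T`, hence reaches `u` at some `s` in `(t,
      -- T]`, still at a positive price.
      obtain ⟨s, hs, hse⟩ := intermediate_value_Icc h.le (hcont t T ht.le)
        (⟨h1.le, by simp only [hδT]; rw [← hδT i]; exact π.mono ht.le h.le i⟩ :
          π.δ t i ∈ Icc (π.δ t j) (π.δ T j))
      have hts : t < s := by
        refine lt_of_le_of_ne hs.1 ?_
        rintro rfl
        exact h1.ne hse
      have hyj' := hpath s (ht.trans hts)
        (hpT.le.trans (π.p_anti (ht.le.trans hts.le) hs.2)) hse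
      have hlt : y j u < y i u := by
        rw [hyi, hyj', CRA.BorderPath.winProb, Real.exp_lt_exp]; linarith
      have hu' := hTt.2 h
      exact ⟨iff_of_true hlt hu', iff_of_false (fun hh => hlt.ne' hh.1) hu'.ne',
        iff_of_false hlt.not_gt fun hh => hu'.not_gt hh.1⟩
    · subst h
      have hyj' := hpath T hTpos hpT.le (by rw [hδT, hδT])
      have he : y i u = y j u := by rw [hyi, hyj', CRA.BorderPath.winProb]
      have hu' : u = Real.exp (-L) := by rw [← hqt, hqT]
      have hp : 0 < y j u := by rw [hyj']; exact Real.exp_pos _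
      exact ⟨iff_of_false he.not_gt hu'.not_gt, iff_of_true ⟨he, hp⟩ hu',
        iff_of_false he.not_lt fun hh => hu'.not_lt hh.1⟩
    · have h1 : π.δ t i < π.δ t j := by
        rcases lt_trichotomy (π.δ t j) (π.δ t i) with h1 | h1 | h1
        · exact absurd (hgt t ht.le h1) h.not_gt
        · exact absurd (heq t ht h1.symm) h.ne'
        · exact h1
      obtain ⟨s, hs, hse⟩ := intermediate_value_Icc h.le (hcont T t hTpos.le)
        (⟨by simp only [hδT]; rw [← hδT i]; exact π.mono hTpos.le h.le i, h1.le⟩ :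
          π.δ t i ∈ Icc (π.δ T j) (π.δ t j))
      have hst : s < t := by
        refine lt_of_le_of_ne hs.2 ?_
        rintro rfl
        exact h1.ne' hse
      have hs0 : 0 < s := hTpos.trans_le hs.1
      have hyj' := hpath s hs0 (hpt.trans (π.p_anti hs0.le hst.le)) hse
      have hlt : y i u < y j u := by
        rw [hyi, hyj', CRA.BorderPath.winProb, Real.exp_lt_exp]; linarith
      have hu' := htT.2 h
      have hp : 0 < y j u := by rw [hyj']; exact Real.exp_pos _
      exact ⟨iff_of_false hlt.not_gt hu'.not_gt, iff_of_false (fun hh => hlt.ne hh.1) hu'.ne,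
        iff_of_true hlt ⟨hu', hp⟩⟩
  · have hB : y i u = 0 ∧ u < Real.exp (-L) := by
      by_cases hex : ∃ t, 0 ≤ t ∧ π.quantile t i ≤ u
      · obtain ⟨t', ht', hq⟩ := hex
        obtain ⟨t, ht, _, hqt⟩ := π.exists_quantile_eq hu.2.le i ht' hq
        have ht0 : 0 < t := by
          refine lt_of_le_of_ne ht ?_
          rintro rfl
          rw [π.quantile_zero] at hqt
          exact hu.2.ne hqt.symm
        have hpt : π.p t < 0 := by
          by_contra hcon
          exact hA ⟨t, ht0, not_lt.1 hcon, hqt⟩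
        obtain ⟨s, hs, hs0⟩ := intermediate_value_Icc' ht
          ((π.p_continuousOn i).mono fun x hx => hx.1) ⟨hpt.le, π.p_zero_pos.le⟩
        have hst : s < t := by
          refine lt_of_le_of_ne hs.2 ?_
          rintro rfl
          exact hpt.ne hs0
        refine ⟨π.optimal_eq_zero hy hi hu.1 hs.1 hs0.le ?_, ?_⟩
        · rw [← hqt]; exact (π.quantile_lt_iff ht hs.1 i).2 hst
        · rw [← hqT i, ← hqt, π.quantile_lt_iff ht hTpos.le]
          exact (π.anti.lt_iff_gt ht (hTpos.le : T ∈ Ici (0 : ℝ))).1 (hpt.trans hpT)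
      · push Not at hex
        refine ⟨?_, by rw [← hqT i]; exact hex T hTpos.le⟩
        -- If the price never drops to zero, `y i` agrees with the path at all its quantiles for `t
        -- > 0`. These all exceed `u`, so `u * y i u ≤ e^{-t}` for every such `t`.
        by_cases hneg : ∃ t, 0 ≤ t ∧ π.p t ≤ 0
        · obtain ⟨t, ht, hpt⟩ := hneg
          exact π.optimal_eq_zero hy hi hu.1 ht hpt (hex t ht)
        · push Not at hneg
          have h1 : ∀ t, 0 < t → y i u ≤ π.winProb t i := fun t ht => by
            rw [← π.optimal_quantile hy ht (hneg t ht.le).le i]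
            exact (hy.1.1 i).mono huI (π.quantile_mem ht.le i) (hex t ht.le).le
          refine π.eq_zero_of_forall_le hu.1 ((hy.1.1 i).mem u huI).1 fun t ht =>
            ⟨(hex t ht).le, ?_⟩
          rcases ht.eq_or_lt with rfl | ht
          · rw [π.winProb_zero]; exact ((hy.1.1 i).mem u huI).2
          · exact h1 t ht
    obtain ⟨hB0, hBu⟩ := hB
    rw [hB0]
    refine ⟨iff_of_false (not_lt.2 hyj.1) hBu.not_gt, iff_of_false (fun hh => ?_) hBu.ne,
      ⟨fun hh => ⟨hBu, hh⟩, fun hh => hh.2⟩⟩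
    exact hh.2.ne hh.1
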